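/- **Setting.** Let $\mathsf T$ be a finite set of primitive tests, and let $\mathsf{Act}$ (actions) and $\mathsf{Out}$ (return values) be sets. Tests $b,c$ are the Boolean terms $0,1,t,b+c,bc,\bar b$ ($t\in\mathsf T$), and $\mathsf{At}$ is the set of atoms of the free Boolean algebra on $\mathsf T$ (tests modulo Boolean equivalence). ProbGKAT expressions are $$e,f ::= p\in\mathsf{Act}\mid b\mid e+_b f\mid e;f\mid e^{(b)}\mid v\in\mathsf{Out}\mid e\oplus_r f\mid e^{[r]}\qquad(r\in[0,1]),$$ forming the set $\mathtt{Exp}$ (sequencing $;$ binds tighter than $+_b$ and $\oplus_r$). Let $\checkmark$ and $\bot$ be symbols for acceptance and rejection. An automaton is a set $X$ with $\beta:X\times\mathsf{At}\to\mathcal D_\omega(\{\bot{},\checkmark{}\}+\mathsf{Out}+\mathsf{Act}\times X)$, where $\mathcal D_\omega$ denotes finitely supported probability distributions. $\mathtt{Exp}$ is an automaton under the derivative $\partial$: for $\alpha\in\mathsf{At}$, $\partial(p)_\alpha=\delta_{(p,1)}$; $\partial(v)_\alpha=\delta_v$; $\partial(b)_\alpha=\delta_\checkmark{}$ if $\alpha\le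 b$, else $\delta_\bot{}$; $\partial(e+_bf)_\alpha=\partial(e)_\alpha$ if $\alpha\le b$, else $\partial(f)_\alpha$; $\partial(e\oplus_rf)_\alpha=r\,\partial(e)_\alpha+(1-r)\,\partial(f)_\alpha$; $\partial(e;f)_\alpha$ is obtained from $\partial(e)_\alpha$ by replacing $\checkmark{}$ with $\partial(f)_\alpha$ and each $(p,e')$ with $(p,\,e';f)$; $\partial(e^{[r]})_\alpha=\delta_\bot{}$ if $r=1=\partial(e)_\alpha(\checkmark{})$, and otherwise it gives $\checkmark{}$ mass $\frac{1-r}{D}$, each $o\in\{\bot{}\}\cup\mathsf{Out}$ mass $\frac{r\,\partial(e)_\alpha(o)}{D}$ and each $(p,\,e';e^{[r]})$ mass $\frac{r\,\partial(e)_\alpha(p,e')}{D}$, with $D=1-r\,\partial(e)_\alpha(\checkmark{})$; $\partial(e^{(b)})_\alpha=\delta_\checkmark{}$ if $\alpha\not\le b$, and if $\alpha\le b$ it is given by the clause for $e^{[r]}$ at $r=1$, with $e^{(b)}$ in place of $e^{[r]}$ in the successor states. A homomorphism $(X,\beta)\to(Y,\gamma)$ is a map $f:X\to Y$ such that each $\gamma(f(x))_\alpha$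 is the image of the distribution $\beta(x)_\alpha$ under $f$ applied to successor states. A relation $R\subseteq X\times Y$ between automata is a bisimulation if it carries an automaton structure for which both projections are homomorphisms; $\sim$ is bisimilarity on $(\mathtt{Exp},\partial)$ (being related by some bisimulation). **Axioms.** Let $\mathsf E(e)_\alpha\in[0,1]$ be given by $\mathsf E(p)_\alpha=\mathsf E(v)_\alpha=0$; $\mathsf E(b)_\alpha=1$ if $\alpha\le b$, else $0$; $\mathsf E(e+_bf)_\alpha=\mathsf E(e)_\alpha$ if $\alpha\le b$, else $\mathsf E(f)_\alpha$; $\mathsf E(e\oplus_rf)_\alpha=r\mathsf E(e)_\alpha+(1-r)\mathsf E(f)_\alpha$; $\mathsf E(e;f)_\alpha=\mathsf E(e)_\alpha\mathsf E(f)_\alpha$; $\mathsf E(e^{(b)})_\alpha=\mathsf E(\bar b)_\alpha$; $\mathsf E(e^{[r]})_\alpha=0$ if $r=1=\mathsf E(e)_\alpha$, else $\frac{1-r}{1-r\mathsf E(e)_\alpha}$. Write $\mathsf E(e)=0$ if $\mathsf E(e)_\alpha=0$ for all $\alpha$. Let $\equiv$ be the least congruence on $\mathtt{Exp}$ in which Boolean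 equivalent tests are interchangeable (as expressions and as guards) and which satisfies - (G1) $e+_be\equiv e$; (G2) $e+_bf\equiv b;e+_bf$; (G3) $e+_bf\equiv f+_{\bar b}e$; (G4) $(e+_bf)+_cg\equiv e+_{bc}(f+_cg)$; - (D) $e\oplus_r(f+_bg)\equiv(e\oplus_rf)+_b(e\oplus_rg)$; - (S1) $1;e\equiv e$; (S2) $e;1\equiv e$; (S3) $(e;f);g\equiv e;(f;g)$; (S4) $0;e\equiv0$; (S5) $(e+_bf);g\equiv e;g+_bf;g$; (S6) $(e\oplus_rf);g\equiv e;g\oplus_rf;g$; (S7) $v;e\equiv v$; (S8) $b;c\equiv bc$; - (P1) $e\oplus_re\equiv e$; (P2) $e\oplus_1f\equiv e$; (P3) $e\oplus_rf\equiv f\oplus_{1-r}e$; (P4) $(e\oplus_rf)\oplus_sg\equiv e\oplus_{rs}(f\oplus_{\frac{(1-r)s}{1-rs}}g)$ if $rs\ne1$; - (L1) $e^{(b)}\equiv e;e^{(b)}+_b1$; (L2) $e^{[r]}\equiv e;e^{[r]}\oplus_r1$; (L3) $(e+_c1)^{(b)}\equiv(c;e)^{(b)}$; (L4) $e^{(1)}\equiv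 e^{[1]}$; - (L5) if $e\equiv(f\oplus_s1)+_cg$ and $s>0$ then $c;e^{(b)}\equiv c;(f;e^{(b)}+_b1)$; - (L6) if $e\equiv(f\oplus_s1)+_cg$ and $r(1-s)\ne1$ then $c;e^{[r]}\equiv c;(f;e^{[r]}\oplus_{\frac{rs}{1-r(1-s)}}1)$; - (F1) if $g\equiv e;g+_bf$ and $\mathsf E(e)=0$ then $g\equiv e^{(b)};f$; (F2) if $g\equiv e;g\oplus_rf$ and $\mathsf E(e)=0$ then $g\equiv e^{[r]};f$. **Uniqueness axiom.** For a finite set $X$ of indeterminates let $\mathtt{PExp}(X)::=f\mid gx\mid p_1\oplus_rp_2$ and $\mathtt{Exp}(X)::=p\mid e_1+_be_2$, with $f,g\in\mathtt{Exp}$, $x\in X$, $p,p_1,p_2\in\mathtt{PExp}(X)$. A Salomaa system is a map $\tau:X\to\mathtt{Exp}(X)$ such that $\mathsf E(g)=0$ for every subterm $gx$ of every $\tau(x)$. For $h:X\to\mathtt{Exp}$ let $h^\#:\mathtt{Exp}(X)\to\mathtt{Exp}$ replace each $gx$ by $g;h(x)$; $h$ is a solution of $\tau$ up to a relation $R$ if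 $(h(x),h^\#(\tau(x)))\in R$ for all $x$. A relation $R$ on $\mathtt{Exp}$ satisfies (UA) if for any Salomaa system and any two solutions $f,g$ of it up to $R$, $(f(x),g(x))\in R$ for all $x\in X$. Let $\mathrel{\dot\equiv}$ be the least congruence that contains $\equiv$ and satisfies (UA). **Behavioural distance.** For a relation $R$ on $\mathtt{Exp}$ let $(e,f)\in\Phi(R)$ if for all $\alpha\in\mathsf{At}$: $\partial(e)_\alpha(o)=\partial(f)_\alpha(o)$ for all $o\in\{\bot{},\checkmark{}\}\cup\mathsf{Out}$, and for all $p\in\mathsf{Act}$ and $A\subseteq\mathtt{Exp}$, $\partial(e)_\alpha[\{p\}\times A]\le\partial(f)_\alpha[\{p\}\times R(A)]$ and $\partial(f)_\alpha[\{p\}\times A]\le\partial(e)_\alpha[\{p\}\times R^{-1}(A)]$. Put $\sim^{(0)}=\mathtt{Exp}\times\mathtt{Exp}$, $\sim^{(n+1)}=\Phi(\sim^{(n)})$. Let $d(e,f)=0$ if $e\sim f$, and otherwise $d(e,f)=2^{-n}$ with $n$ maximal such that $e\sim^{(n)}f$. On $\mathtt{Exp}^X$ put $d(h,k)=\max_{x\in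 X}d(h(x),k(x))$ (and $0$ if $X=\emptyset$). **Theorem (Soundness with UA).** 1. For all $e,f\in\mathtt{Exp}$, if $e\mathrel{\dot\equiv}f$ then $e\sim f$. 2. Bisimilarity $\sim$ satisfies (UA). 3. If $e\not\sim f$, a maximal $n$ with $e\sim^{(n)}f$ exists, so $d$ is well defined; and $d$ is a pseudo-ultrametric on $\mathtt{Exp}$: $d(e,e)=0$, $d(e,f)=d(f,e)$, $d(e,g)\le\max\{d(e,f),d(f,g)\}$. 4. For every Salomaa system $\tau:X\to\mathtt{Exp}(X)$ the map $\bar\tau:\mathtt{Exp}^X\to\mathtt{Exp}^X$, $\bar\tau(h)=h^\#\circ\tau$, is $\tfrac12$-Lipschitz for $d$. -/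

import Mathlib

namespace ProbGKAT

universe u v w

/-! ### Tests and atoms -/

/-- Boolean tests over a set `T` of primitive tests. -/
inductive BExp (T : Type u) : Type u
  | zero : BExp T
  | one : BExp T
  | prim (t : T) : BExp T
  | or (b c : BExp T) : BExp T
  | and (b c : BExp T) : BExp T
  | not (b : BExp T) : BExp T

/-- The truth value of a test under a valuation of the primitive tests. -/
def BExp.eval {T : Type u} (val : T → Bool) : BExp T → Bool
  | .zero => false
  | .one => true
  | .prim t => val t
  | .or b c => b.eval val || c.eval val
  | .and b c => b.eval val && c.eval val
  | .not b => !(b.eval val)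

/-- Boolean equivalence of tests: the same truth value under every valuation. -/
def BEquiv {T : Type u} (b c : BExp T) : Prop := ∀ val : T → Bool, b.eval val = c.eval val

/-- Boolean equivalence as a setoid. -/
def bSetoid (T : Type u) : Setoid (BExp T) where
  r := BEquiv
  iseqv := ⟨fun _ _ => rfl, fun h val => (h val).symm, fun h k val => (h val).trans (k val)⟩

/-- Tests modulo Boolean equivalence: the carrier of the free Boolean algebra on `T`. -/
def BAlg (T : Type u) : Type u := Quotient (bSetoid T)

/-- The class of a test modulo Boolean equivalence. -/
def BExp.cls {T : Type u} (b : BExp T) : BAlg T := Quotient.mk (bSetoid T) b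

theorem BExp.cls_eq {T : Type u} {b c : BExp T} : b.cls = c.cls ↔ BEquiv b c :=
  ⟨fun h => Quotient.exact h, fun h => Quotient.sound (s := bSetoid T) h⟩

/-- Entailment of classes: `[b] ≤ [c]` iff `b + c` is Boolean equivalent to `c`. -/
instance instLEBAlg (T : Type u) : LE (BAlg T) where
  le x y := Quotient.liftOn₂ x y (fun b c => BEquiv (b.or c) c) (by
    intro b c b' c' hb hc
    have hb' : ∀ val, b.eval val = b'.eval val := hb
    have hc' : ∀ val, c.eval val = c'.eval val := hc
    simp only [BEquiv, BExp.eval, hb', hc'])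

theorem BExp.cls_le {T : Type u} {b c : BExp T} :
    b.cls ≤ c.cls ↔ BEquiv (b.or c) c := Iff.rfl

theorem BExp.cls_le_iff {T : Type u} {b c : BExp T} :
    b.cls ≤ c.cls ↔ ∀ val : T → Bool, b.eval val = true → c.eval val = true := by
  rw [BExp.cls_le]
  refine forall_congr' fun val => ?_
  simp only [BExp.eval]
  cases b.eval val <;> cases c.eval val <;> simp

instance instPartialOrderBAlg (T : Type u) : PartialOrder (BAlg T) where
  le_refl x := by
    induction x using Quotient.inductionOn with | _ b =>
    exact BExp.cls_le_iff.2 fun _ h => h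
  le_trans x y z := by
    induction x using Quotient.inductionOn with | _ b =>
    induction y using Quotient.inductionOn with | _ c =>
    induction z using Quotient.inductionOn with | _ d =>
    intro h k
    exact BExp.cls_le_iff.2 fun val hb => BExp.cls_le_iff.1 k val (BExp.cls_le_iff.1 h val hb)
  le_antisymm x y := by
    induction x using Quotient.inductionOn with | _ b =>
    induction y using Quotient.inductionOn with | _ c =>
    intro h k
    refine BExp.cls_eq.2 fun val => Bool.eq_iff_iff.2 ?_
    exact ⟨BExp.cls_le_iff.1 h val, BExp.cls_le_iff.1 k val⟩

/-- The least class is the class of the test `0`. -/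
instance instOrderBotBAlg (T : Type u) : OrderBot (BAlg T) where
  bot := BExp.zero.cls
  bot_le x := by
    induction x using Quotient.inductionOn with | _ b =>
    exact BExp.cls_le_iff.2 fun val h => by simp [BExp.eval] at h

/-- `At`: the minimal non-zero elements of the free Boolean algebra on `T`. -/
abbrev Atom (T : Type u) : Type u := {a : BAlg T // IsAtom a}

/-- `α ≤ b` in the entailment order. -/
def Atom.Sat {T : Type u} (α : Atom T) (b : BExp T) : Prop := α.1 ≤ b.cls

/-- An atom lies below exactly one of `b` and its negation, so that the two-case definitions
below may be written with `if α.Sat b then … else …`. -/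
theorem Atom.sat_not {T : Type u} (α : Atom T) (b : BExp T) :
    α.Sat b.not ↔ ¬ α.Sat b := by
  obtain ⟨a, ha⟩ := α
  induction a using Quotient.inductionOn with | _ c =>
  change IsAtom c.cls at ha
  change c.cls ≤ b.not.cls ↔ ¬ c.cls ≤ b.cls
  constructor
  · intro h k
    apply ha.1
    refine le_bot_iff.1 (BExp.cls_le_iff.2 fun val hc => ?_)
    have h1 := BExp.cls_le_iff.1 h val hc
    have h2 := BExp.cls_le_iff.1 k val hc
    simp [BExp.eval, h2] at h1
  · intro h
    have hle : (c.and b).cls ≤ c.cls := BExp.cls_le_iff.2 fun val hc => by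
      simp only [BExp.eval, Bool.and_eq_true] at hc; exact hc.1
    rcases hle.lt_or_eq with hlt | heq
    · have h0 := BExp.cls_eq.1 (ha.2 _ hlt : (c.and b).cls = BExp.zero.cls)
      refine BExp.cls_le_iff.2 fun val hc => ?_
      have := h0 val
      simp only [BExp.eval, hc, Bool.true_and] at this
      simp [BExp.eval, this]
    · refine absurd (BExp.cls_le_iff.2 fun val hc => ?_) h
      have := BExp.cls_eq.1 heq val
      simpa only [BExp.eval, hc, Bool.true_and] using this

/-! ### Expressions -/

/-- ProbGKAT expressions over primitive tests `T`, actions `Act` and return values `Out`. -/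
inductive Exp (T : Type u) (Act : Type v) (Out : Type w) : Type (max u v w)
  /-- `do p` -/
  | act (p : Act) : Exp T Act Out
  /-- `assert b` -/
  | test (b : BExp T) : Exp T Act Out
  /-- `e +_b f`: `if b then e else f` -/
  | gchoice (b : BExp T) (e f : Exp T Act Out) : Exp T Act Out
  /-- `e ; f` -/
  | seq (e f : Exp T Act Out) : Exp T Act Out
  /-- `e^(b)`: `while b do e` -/
  | gloop (b : BExp T) (e : Exp T Act Out) : Exp T Act Out
  /-- `return v` -/
  | ret (v : Out) : Exp T Act Out
  /-- `e ⊕_r f`: `if flip(r) then e else f` -/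
  | pchoice (r : unitInterval) (e f : Exp T Act Out) : Exp T Act Out
  /-- `e^[r]`: `while flip(r) do e` -/
  | ploop (r : unitInterval) (e : Exp T Act Out) : Exp T Act Out

/-! ### Automata -/

/-- Finitely supported probability distributions. -/
abbrev Dist (X : Type*) := Convexity.StdSimplex ℝ X

/-- `ν[A]`, the mass that `ν` gives to the set `A`. -/
noncomputable def mass {X : Type*} (ν : Dist X) (A : Set X) : ℝ :=
  open Classical in ∑ x ∈ ν.weights.support with x ∈ A, ν.weights x

/-- The set `2 + Out + Act × X` of outcomes of a transition. -/
inductive Outcome (Act : Type*) (Out : Type*) (X : Type*)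
  | reject
  | accept
  | ret (v : Out)
  | step (p : Act) (x : X)

/-- `{p} × A` as a set of outcomes. -/
def stepSet {Act Out X : Type*} (p : Act) (A : Set X) : Set (Outcome Act Out X) :=
  {o | ∃ x ∈ A, o = .step p x}

/-- An automaton with states `X`: the transition function `X × At → D(2 + Out + Act × X)`. -/
abbrev Automaton (T Act Out X : Type*) := X → Atom T → Dist (Outcome Act Out X)

section Automata

variable {T Act Out X Y : Type*}

/-- `ν` and `μ` agree on `2 + Out`. -/
def SameOutputs (ν : Dist (Outcome Act Out X)) (μ : Dist (Outcome Act Out Y)) : Prop :=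
  ν.weights .reject = μ.weights .reject ∧ ν.weights .accept = μ.weights .accept ∧
    ∀ v : Out, ν.weights (.ret v) = μ.weights (.ret v)

/-- Homomorphisms of automata. -/
def IsHom (β : Automaton T Act Out X) (γ : Automaton T Act Out Y) (f : X → Y) : Prop :=
  ∀ x α, SameOutputs (γ (f x) α) (β x α) ∧
    ∀ p y, (γ (f x) α).weights (.step p y) = mass (β x α) (stepSet p (f ⁻¹' {y}))

/-- `R` is a bisimulation: it carries a transition function for which both projections are
homomorphisms. -/
def IsBisimulation (β : Automaton T Act Out X) (γ : Automaton T Act Out Y)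
    (R : X → Y → Prop) : Prop :=
  ∃ ρ : Automaton T Act Out {q : X × Y // R q.1 q.2},
    IsHom ρ β (fun q => q.1.1) ∧ IsHom ρ γ (fun q => q.1.2)

/-- Bisimilarity: membership in some bisimulation. -/
def Bisimilar (β : Automaton T Act Out X) (γ : Automaton T Act Out Y) (x : X) (y : Y) : Prop :=
  ∃ R : X → Y → Prop, IsBisimulation β γ R ∧ R x y

/-- The operator `Φ` on relations. -/
def Phi (β : Automaton T Act Out X) (γ : Automaton T Act Out Y) (R : X → Y → Prop) :
    X → Y → Prop := fun x y =>
  ∀ α, SameOutputs (β x α) (γ y α) ∧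
    (∀ (A : Set X) (p : Act),
      mass (β x α) (stepSet p A) ≤ mass (γ y α) (stepSet p {y' | ∃ x' ∈ A, R x' y'})) ∧
    (∀ (B : Set Y) (p : Act),
      mass (γ y α) (stepSet p B) ≤ mass (β x α) (stepSet p {x' | ∃ y' ∈ B, R x' y'}))

/-- The relation refinement chain: `∼⁽⁰⁾` is the full relation, `∼⁽ⁿ⁺¹⁾ = Φ(∼⁽ⁿ⁾)`. -/
def chain (β : Automaton T Act Out X) : ℕ → X → X → Prop
  | 0 => fun _ _ => True
  | n + 1 => Phi β β (chain β n)

/-- The behavioural pseudometric: `0` on bisimilar states, and otherwise `2⁻ⁿ` for the maximal `n`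
with `x ∼⁽ⁿ⁾ y`. -/
noncomputable def bdist (β : Automaton T Act Out X) (x y : X) : ℝ :=
  open Classical in
  if Bisimilar β β x y then 0 else ((2 : ℝ) ^ sSup {n : ℕ | chain β n x y})⁻¹

/-- The product (maximum) pseudometric on families of states. -/
noncomputable def prodDist {I : Type*} (β : Automaton T Act Out X) (m n : I → X) : ℝ :=
  ⨆ i, bdist β (m i) (n i)

end Automata

/-! ### The Brzozowski automaton on expressions -/

section Semantics

variable {T : Type u} {Act : Type v} {Out : Type w}

/-- `k ∘ -` on the successor states of outcomes. -/
def Outcome.map {X Y : Type*} (k : X → Y) : Outcome Act Out X → Outcome Act Out Y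
  | .reject => .reject
  | .accept => .accept
  | .ret v => .ret v
  | .step p x => .step p (k x)

theorem weight_le_one {X : Type*} (ν : Dist X) (x : X) : ν.weights x ≤ 1 := by
  classical
  by_cases hx : x ∈ ν.weights.support
  · have h := Finset.single_le_sum (f := fun y => ν.weights y) (fun y _ => ν.nonneg y) hx
    have ht : ∑ y ∈ ν.weights.support, ν.weights y = 1 := ν.total
    exact h.trans ht.le
  · rw [Finsupp.notMem_support_iff.1 hx]; exact zero_le_one

theorem loop_denom_pos {X : Type*} (r : unitInterval) (ν : Dist X) (x : X)
    (h : ¬(r = 1 ∧ ν.weights x = 1)) : 0 < 1 - (r : ℝ) * ν.weights x := by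
  have h0 := ν.nonneg x
  have h1 := weight_le_one ν x
  have r0 := r.2.1
  have r1 := r.2.2
  simp only [Finsupp.coe_zero, Pi.zero_apply] at h0
  by_contra hc
  have hr : (r : ℝ) = 1 := by nlinarith
  have hx : ν.weights x = 1 := by nlinarith
  exact h ⟨Subtype.ext hr, hx⟩

/-- The one-step behaviour of a loop that enters its body with probability `r`, when the body
behaves as `ν` and `k` appends the loop to the successor states of the body. The immediate
acceptance of the body is discarded, its mass being redistributed:
`✓` gets `(1 - r) / (1 - r ν(✓))`, an output `o ≠ ✓` gets `r ν(o) / (1 - r ν(✓))`, and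
`(p, k x)` gets `r ν(p, x) / (1 - r ν(✓))`. -/
noncomputable def loopDist {X : Type*} (r : unitInterval) (ν : Dist (Outcome Act Out X))
    (k : X → X) (h : ¬(r = 1 ∧ ν.weights .accept = 1)) : Dist (Outcome Act Out X) where
  weights :=
    Finsupp.single .accept ((1 - (r : ℝ)) / (1 - r * ν.weights .accept)) +
      ((r : ℝ) / (1 - r * ν.weights .accept)) •
        Finsupp.mapDomain (Outcome.map k) (ν.weights.erase .accept)
  nonneg := by
    have hd := loop_denom_pos r ν .accept h
    refine add_nonneg ?_ (smul_nonneg (div_nonneg r.2.1 hd.le) ?_)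
    · exact Finsupp.single_nonneg.2 (div_nonneg (sub_nonneg.2 r.2.2) hd.le)
    · refine Finsupp.mapDomain_nonneg fun o => ?_
      by_cases ho : o = .accept
      · subst ho; simp
      · rw [Finsupp.erase_ne ho]; exact ν.nonneg o
  total := by
    classical
    have hd := loop_denom_pos r ν .accept h
    have he : (ν.weights.erase .accept).sum (fun _ s => s) = 1 - ν.weights .accept := by
      have := Finsupp.add_sum_erase' ν.weights .accept (fun _ s => s) (fun _ => rfl)
      rw [ν.total] at this
      linarith
    rw [Finsupp.sum_add_index' (fun _ => rfl) (fun _ _ _ => rfl),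
      Finsupp.sum_single_index rfl, Finsupp.sum_smul_index (fun _ => rfl),
      ← Finsupp.mul_sum, Finsupp.sum_mapDomain_index (fun _ => rfl) (fun _ _ _ => rfl), he]
    field_simp
    ring

/-- The Brzozowski derivative `∂`. In the clause for `e ; f`, `Convexity.iConvexComb ν c` is the
convex extension of `c` applied to `ν`. A guarded loop whose guard holds enters its body with
probability `1`. -/
noncomputable def deriv : Automaton T Act Out (Exp T Act Out)
  | .act p, _ => .single (.step p (.test .one))
  | .test b, α => open Classical in if α.Sat b then .single .accept else .single .reject
  | .gchoice b e f, α => open Classical in if α.Sat b then deriv e α else deriv f α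
  | .ret v, _ => .single (.ret v)
  | .pchoice r e f, α =>
      Convexity.convexCombPair (r : ℝ) (1 - r) r.2.1 (sub_nonneg.2 r.2.2) (by ring)
        (deriv e α) (deriv f α)
  | .seq e f, α =>
      Convexity.iConvexComb (deriv e α) fun o =>
        match o with
        | .reject => Convexity.StdSimplex.single .reject
        | .accept => deriv f α
        | .ret v => Convexity.StdSimplex.single (.ret v)
        | .step p e' => Convexity.StdSimplex.single (.step p (.seq e' f))
  | .gloop b e, α => open Classical in
      if α.Sat b then
        if h : (1 : unitInterval) = 1 ∧ (deriv e α).weights .accept = 1 then .single .reject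
        else loopDist 1 (deriv e α) (fun e' => .seq e' (.gloop b e)) h
      else .single .accept
  | .ploop r e, α => open Classical in
      if h : r = 1 ∧ (deriv e α).weights .accept = 1 then .single .reject
      else loopDist r (deriv e α) (fun e' => .seq e' (.ploop r e)) h

/-- Bisimilarity of expressions. -/
def Bisim (e f : Exp T Act Out) : Prop := Bisimilar deriv deriv e f

/-! ### The axiomatisation -/

/-- The termination probability `E(e)_α`. -/
noncomputable def term : Exp T Act Out → Atom T → ℝ
  | .act _, _ => 0
  | .ret _, _ => 0
  | .test b, α => open Classical in if α.Sat b then 1 else 0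
  | .gchoice b e f, α => open Classical in if α.Sat b then term e α else term f α
  | .pchoice r e f, α => r * term e α + (1 - r) * term f α
  | .seq e f, α => term e α * term f α
  | .gloop b _, α => open Classical in if α.Sat b.not then 1 else 0
  | .ploop r e, α => open Classical in
      if r = 1 ∧ term e α = 1 then 0 else (1 - r) / (1 - r * term e α)

open unitInterval in
/-- Provable equivalence `≡`: the least congruence that satisfies the axioms. Tests are taken up to
Boolean equivalence (the last three rules). A probability written as a fraction appears as a
`t ∈ [0,1]` that equals the fraction, whose denominator is required not to vanish. -/
inductive ProvEq : Exp T Act Out → Exp T Act Out → Prop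
  | refl (e) : ProvEq e e
  | symm {e f} : ProvEq e f → ProvEq f e
  | trans {e f g} : ProvEq e f → ProvEq f g → ProvEq e g
  | gchoice_congr (b) {e e' f f'} : ProvEq e e' → ProvEq f f' →
      ProvEq (.gchoice b e f) (.gchoice b e' f')
  | seq_congr {e e' f f'} : ProvEq e e' → ProvEq f f' → ProvEq (.seq e f) (.seq e' f')
  | gloop_congr (b) {e e'} : ProvEq e e' → ProvEq (.gloop b e) (.gloop b e')
  | pchoice_congr (r) {e e' f f'} : ProvEq e e' → ProvEq f f' →
      ProvEq (.pchoice r e f) (.pchoice r e' f')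
  | ploop_congr (r) {e e'} : ProvEq e e' → ProvEq (.ploop r e) (.ploop r e')
  -- guarded choice
  | G1 (b e) : ProvEq (.gchoice b e e) e
  | G2 (b e f) : ProvEq (.gchoice b e f) (.gchoice b (.seq (.test b) e) f)
  | G3 (b e f) : ProvEq (.gchoice b e f) (.gchoice b.not f e)
  | G4 (b c e f g) :
      ProvEq (.gchoice c (.gchoice b e f) g) (.gchoice (b.and c) e (.gchoice c f g))
  -- distributivity
  | D (r b e f g) :
      ProvEq (.pchoice r e (.gchoice b f g)) (.gchoice b (.pchoice r e f) (.pchoice r e g))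
  -- sequencing
  | S1 (e) : ProvEq (.seq (.test .one) e) e
  | S2 (e) : ProvEq (.seq e (.test .one)) e
  | S3 (e f g) : ProvEq (.seq (.seq e f) g) (.seq e (.seq f g))
  | S4 (e) : ProvEq (.seq (.test .zero) e) (.test .zero)
  | S5 (b e f g) : ProvEq (.seq (.gchoice b e f) g) (.gchoice b (.seq e g) (.seq f g))
  | S6 (r e f g) : ProvEq (.seq (.pchoice r e f) g) (.pchoice r (.seq e g) (.seq f g))
  | S7 (v e) : ProvEq (.seq (.ret v) e) (.ret v)
  | S8 (b c) : ProvEq (.seq (.test b) (.test c)) (.test (b.and c))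
  -- probabilistic choice
  | P1 (r e) : ProvEq (.pchoice r e e) e
  | P2 (e f) : ProvEq (.pchoice 1 e f) e
  | P3 (r e f) : ProvEq (.pchoice r e f) (.pchoice (σ r) f e)
  | P4 (r s t : unitInterval) (e f g) : (1 - r * s : ℝ) ≠ 0 →
      (t : ℝ) = (1 - r) * s / (1 - r * s) →
      ProvEq (.pchoice s (.pchoice r e f) g) (.pchoice (r * s) e (.pchoice t f g))
  -- loops
  | L1 (b e) : ProvEq (.gloop b e) (.gchoice b (.seq e (.gloop b e)) (.test .one))
  | L2 (r e) : ProvEq (.ploop r e) (.pchoice r (.seq e (.ploop r e)) (.test .one))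
  | L3 (b c e) :
      ProvEq (.gloop b (.gchoice c e (.test .one))) (.gloop b (.seq (.test c) e))
  | L4 (e) : ProvEq (.gloop .one e) (.ploop 1 e)
  | L5 (b c) (s : unitInterval) (e f g) :
      ProvEq e (.gchoice c (.pchoice s f (.test .one)) g) → (0 : ℝ) < s →
      ProvEq (.seq (.test c) (.gloop b e))
        (.seq (.test c) (.gchoice b (.seq f (.gloop b e)) (.test .one)))
  | L6 (c) (r s t : unitInterval) (e f g) :
      ProvEq e (.gchoice c (.pchoice s f (.test .one)) g) →
      (1 - r * (1 - s) : ℝ) ≠ 0 → (t : ℝ) = r * s / (1 - r * (1 - s)) →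
      ProvEq (.seq (.test c) (.ploop r e))
        (.seq (.test c) (.pchoice t (.seq f (.ploop r e)) (.test .one)))
  -- fixpoint rules
  | F1 (b e f g) : ProvEq g (.gchoice b (.seq e g) f) → (∀ α, term e α = 0) →
      ProvEq g (.seq (.gloop b e) f)
  | F2 (r e f g) : ProvEq g (.pchoice r (.seq e g) f) → (∀ α, term e α = 0) →
      ProvEq g (.seq (.ploop r e) f)
  -- Boolean algebra
  | test_ba {b c} : BEquiv b c → ProvEq (.test b) (.test c)
  | gchoice_ba {b c} (e f) : BEquiv b c → ProvEq (.gchoice b e f) (.gchoice c e f)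
  | gloop_ba {b c} (e) : BEquiv b c → ProvEq (.gloop b e) (.gloop c e)

/-! ### Systems of equations and the uniqueness axiom -/

/-- The grammar `PExp(X) ::= f | g x | p ⊕_r q`. -/
inductive PTerm (T : Type u) (Act : Type v) (Out : Type w) (X : Type*)
  | exp (f : Exp T Act Out)
  | var (g : Exp T Act Out) (x : X)
  | pchoice (r : unitInterval) (p q : PTerm T Act Out X)

/-- The grammar `Exp(X) ::= p | e +_b f`, with `p` in `PExp(X)`. -/
inductive ETerm (T : Type u) (Act : Type v) (Out : Type w) (X : Type*)
  | pterm (p : PTerm T Act Out X)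
  | gchoice (b : BExp T) (e f : ETerm T Act Out X)

/-- Every subterm `g x` satisfies `E(g) = 0`. -/
def PTerm.IsSalomaa {X : Type*} : PTerm T Act Out X → Prop
  | .exp _ => True
  | .var g _ => ∀ α, term g α = 0
  | .pchoice _ p q => p.IsSalomaa ∧ q.IsSalomaa

/-- Every subterm `g x` satisfies `E(g) = 0`. -/
def ETerm.IsSalomaa {X : Type*} : ETerm T Act Out X → Prop
  | .pterm p => p.IsSalomaa
  | .gchoice _ e f => e.IsSalomaa ∧ f.IsSalomaa

/-- The substitution `h^#` on `PExp(X)`. -/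
def PTerm.subst {X : Type*} (h : X → Exp T Act Out) : PTerm T Act Out X → Exp T Act Out
  | .exp f => f
  | .var g x => .seq g (h x)
  | .pchoice r p q => .pchoice r (p.subst h) (q.subst h)

/-- The substitution `h^#` on `Exp(X)`. -/
def ETerm.subst {X : Type*} (h : X → Exp T Act Out) : ETerm T Act Out X → Exp T Act Out
  | .pterm p => p.subst h
  | .gchoice b e f => .gchoice b (e.subst h) (f.subst h)

/-- The system of equations `τ` is Salomaa. -/
def IsSalomaaSystem {X : Type*} (τ : X → ETerm T Act Out X) : Prop := ∀ x, (τ x).IsSalomaa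

/-- The map `τ̄` on families of expressions induced by a system `τ`. -/
def substMap {X : Type*} (τ : X → ETerm T Act Out X) (h : X → Exp T Act Out) :
    X → Exp T Act Out := fun x => (τ x).subst h

/-- `h` is a solution up to `R` of the system `τ`. -/
def IsSolution {X : Type*} (R : Exp T Act Out → Exp T Act Out → Prop)
    (τ : X → ETerm T Act Out X) (h : X → Exp T Act Out) : Prop :=
  ∀ x, R (h x) ((τ x).subst h)

/-- The relation `R` satisfies the uniqueness axiom UA. -/
def SatisfiesUA (R : Exp T Act Out → Exp T Act Out → Prop) : Prop :=
  ∀ (X : Type) [Finite X] (τ : X → ETerm T Act Out X), IsSalomaaSystem τ →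
    ∀ f g : X → Exp T Act Out, IsSolution R τ f → IsSolution R τ g → ∀ x, R (f x) (g x)

/-- `≡̇`: the least congruence that contains `≡` and satisfies UA. -/
inductive ProvEqUA : Exp T Act Out → Exp T Act Out → Prop
  | of {e f} : ProvEq e f → ProvEqUA e f
  | symm {e f} : ProvEqUA e f → ProvEqUA f e
  | trans {e f g} : ProvEqUA e f → ProvEqUA f g → ProvEqUA e g
  | gchoice_congr (b) {e e' f f'} : ProvEqUA e e' → ProvEqUA f f' →
      ProvEqUA (.gchoice b e f) (.gchoice b e' f')
  | seq_congr {e e' f f'} : ProvEqUA e e' → ProvEqUA f f' → ProvEqUA (.seq e f) (.seq e' f')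
  | gloop_congr (b) {e e'} : ProvEqUA e e' → ProvEqUA (.gloop b e) (.gloop b e')
  | pchoice_congr (r) {e e' f f'} : ProvEqUA e e' → ProvEqUA f f' →
      ProvEqUA (.pchoice r e f) (.pchoice r e' f')
  | ploop_congr (r) {e e'} : ProvEqUA e e' → ProvEqUA (.ploop r e) (.ploop r e')
  | ua (X : Type) [Finite X] (τ : X → ETerm T Act Out X) (hτ : IsSalomaaSystem τ)
      (f g : X → Exp T Act Out)
      (hf : ∀ x, ProvEqUA (f x) ((τ x).subst f)) (hg : ∀ x, ProvEqUA (g x) ((τ x).subst g))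
      (x : X) : ProvEqUA (f x) (g x)

theorem provEqUA_satisfiesUA : SatisfiesUA (ProvEqUA (T := T) (Act := Act) (Out := Out)) :=
  fun X _ τ hτ f g hf hg x => .ua X τ hτ f g hf hg x

end Semantics

end ProbGKAT

namespace ProbGKAT

universe u v w

open Convexity

/-! ### Expectations -/

section Expectation

variable {X Y Z : Type*}

/-! Distributions are compared through expectations of real observables on outcomes, because the
derivative acts on expectations by simple formulas: choices are affine, sequencing changes the
observable (`seqObs`), and loops satisfy a linear fixpoint equation (`expect_loopStep_eq`).

For an equivalence `R`, `Φ(R)` relates two states exactly when their transitions give the same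
expectation to every `R`-invariant observable (`phi_iff_indist`). Hence the levels of the chain are
decreasing equivalences. Bisimilarity is their intersection (`bisimilar_iff_forall_chain`): finite
supports let one level stand for the whole intersection in any given comparison of two transitions,
and a coupling (`exists_coupling`) turns agreement on classes into a bisimulation. Every claim thus
becomes a claim about each level `n`.

Each level is a congruence. A factor `g` with `E(g) = 0` gains a level (`chain_succ_seq_right`): its
continuation becomes visible only after an action. So the map of a Salomaa system sends level `n` to
level `n + 1`; this is the Lipschitz bound, since distance at most `2⁻ⁿ` means level `n`
(`bdist_le_iff`), and by induction on `n` it gives uniqueness of solutions.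

Most axioms preserve all expectations outright. Some hold only up to related successors and need
induction on the level. L5 and L6 solve the linear equation of the loop, and F1 and F2 are
uniqueness for systems in one unknown. -/

/-- The expectation of `φ` under `ν`. -/
noncomputable def expect (ν : Dist X) (φ : X → ℝ) : ℝ := ν.weights.sum fun x s => s * φ x

theorem expect_congr {ν : Dist X} {φ ψ : X → ℝ} (h : ∀ x, ν.weights x ≠ 0 → φ x = ψ x) :
    expect ν φ = expect ν ψ :=
  Finset.sum_congr rfl fun x hx => congrArg (_ * ·) (h x (Finsupp.mem_support_iff.1 hx))

theorem expect_add (ν : Dist X) (φ ψ : X → ℝ) :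
    expect ν (fun x => φ x + ψ x) = expect ν φ + expect ν ψ := by
  simp only [expect, mul_add, Finsupp.sum_add]

theorem expect_const_mul (ν : Dist X) (c : ℝ) (φ : X → ℝ) :
    expect ν (fun x => c * φ x) = c * expect ν φ := by
  simp only [expect, Finsupp.sum, Finset.mul_sum]
  exact Finset.sum_congr rfl fun x _ => by ring

theorem expect_indicator (ν : Dist X) (A : Set X) :
    expect ν (A.indicator 1) = mass ν A := by
  classical
  simp only [expect, mass, Finsupp.sum, Finset.sum_filter, Set.indicator_apply, Pi.one_apply,
    mul_ite, mul_one, mul_zero]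

theorem expect_indicator_singleton (ν : Dist X) (x : X) :
    expect ν (Set.indicator {x} 1) = ν.weights x := by
  classical
  simp only [expect, Finsupp.sum, Set.indicator_apply, Pi.one_apply, mul_ite, mul_one, mul_zero,
    Set.mem_singleton_iff, Finset.sum_ite_eq', Finsupp.mem_support_iff]
  exact ite_eq_left_iff.2 fun h => (not_not.1 h).symm

theorem mass_singleton (ν : Dist X) (x : X) : mass ν {x} = ν.weights x := by
  rw [← expect_indicator, expect_indicator_singleton]

theorem mass_mono (ν : Dist X) {A B : Set X} (h : A ⊆ B) : mass ν A ≤ mass ν B := by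
  classical
  exact Finset.sum_le_sum_of_subset_of_nonneg
    (Finset.monotone_filter_right _ fun x _ hx => h hx) fun x _ _ => ν.nonneg x

@[simp] theorem expect_single (x : X) (φ : X → ℝ) : expect (StdSimplex.single x) φ = φ x := by
  simp [expect]

theorem expect_map (ν : Dist X) (g : X → Y) (φ : Y → ℝ) :
    expect (ν.map g) φ = expect ν (φ ∘ g) := by
  simp only [expect, StdSimplex.weights_map, Function.comp]
  exact Finsupp.sum_mapDomain_index (by simp) (by intros; ring)

theorem weights_map_apply (ν : Dist X) (g : X → Y) (y : Y) :
    (ν.map g).weights y = mass ν (g ⁻¹' {y}) := by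
  rw [← expect_indicator_singleton, expect_map, ← expect_indicator]
  rfl

theorem expect_iConvexComb (ν : Dist X) (c : X → Dist X) (φ : X → ℝ) :
    expect (iConvexComb ν c) φ = expect ν fun x => expect (c x) φ := by
  simp only [expect, StdSimplex.weights_iConvexComb]
  rw [Finsupp.sum_sum_index (by simp) (by intros; ring)]
  refine Finsupp.sum_congr fun x _ => ?_
  rw [Finsupp.sum_smul_index (by simp), Finsupp.mul_sum]
  exact Finsupp.sum_congr fun y _ => by ring

theorem expect_convexCombPair (ν μ : Dist X) (s t : ℝ) (hs ht hst) (φ : X → ℝ) :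
    expect (convexCombPair s t hs ht hst ν μ) φ = s * expect ν φ + t * expect μ φ := by
  classical
  simp only [expect, StdSimplex.weights_convexCombPair]
  rw [Finsupp.sum_add_index' (by simp) (by intros; ring), Finsupp.sum_smul_index (by simp),
    Finsupp.sum_smul_index (by simp), Finsupp.mul_sum, Finsupp.mul_sum]
  simp only [mul_assoc]

theorem eq_of_expect_eq {ν μ : Dist X} (h : ∀ φ, expect ν φ = expect μ φ) : ν = μ :=
  StdSimplex.ext <| Finsupp.ext fun x => by
    rw [← expect_indicator_singleton, h, expect_indicator_singleton]

end Expectation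

/-! ### Invariant observables -/

section Invariant

variable {T Act Out X Y : Type*}

theorem preimage_map_step (f : X → Y) (p : Act) (y : Y) :
    Outcome.map f ⁻¹' {Outcome.step p y} =
      (stepSet p (f ⁻¹' {y}) : Set (Outcome Act Out X)) := by
  ext o
  cases o <;> simp [Outcome.map, stepSet, and_comm, eq_comm]

theorem weights_map_of_preimage {ν : Dist X} {f : X → Y} {x : X} {y : Y}
    (h : f ⁻¹' {y} = {x}) : (ν.map f).weights y = ν.weights x := by
  rw [weights_map_apply, h, mass_singleton]

theorem weights_map_reject (ν : Dist (Outcome Act Out X)) (f : X → Y) :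
    (ν.map (Outcome.map f)).weights .reject = ν.weights .reject :=
  weights_map_of_preimage (by ext o; cases o <;> simp [Outcome.map])

theorem weights_map_accept (ν : Dist (Outcome Act Out X)) (f : X → Y) :
    (ν.map (Outcome.map f)).weights .accept = ν.weights .accept :=
  weights_map_of_preimage (by ext o; cases o <;> simp [Outcome.map])

theorem weights_map_ret (ν : Dist (Outcome Act Out X)) (f : X → Y) (v : Out) :
    (ν.map (Outcome.map f)).weights (.ret v) = ν.weights (.ret v) :=
  weights_map_of_preimage (by ext o; cases o <;> simp [Outcome.map])

theorem weights_map_step (ν : Dist (Outcome Act Out X)) (f : X → Y) (p : Act) (y : Y) :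
    (ν.map (Outcome.map f)).weights (.step p y) = mass ν (stepSet p (f ⁻¹' {y})) := by
  rw [weights_map_apply, preimage_map_step]

/-- A map is a homomorphism iff it pushes the transitions of the source to those of the target. -/
theorem isHom_iff {β : Automaton T Act Out X} {γ : Automaton T Act Out Y} {f : X → Y} :
    IsHom β γ f ↔ ∀ x α, γ (f x) α = (β x α).map (Outcome.map f) := by
  refine forall₂_congr fun x α => ⟨fun ⟨⟨h1, h2, h3⟩, h4⟩ => ?_, fun h => ?_⟩
  · refine StdSimplex.ext (Finsupp.ext fun o => ?_)
    cases o with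
    | reject => rw [h1, weights_map_reject]
    | accept => rw [h2, weights_map_accept]
    | ret v => rw [h3, weights_map_ret]
    | step p y => rw [h4, weights_map_step]
  · rw [h]
    exact ⟨⟨weights_map_reject .., weights_map_accept .., weights_map_ret _ _⟩,
      weights_map_step _ _⟩

/-- `φ` takes equal values on transitions with the same action to `R`-related states. -/
def Invariant (R : X → X → Prop) (φ : Outcome Act Out X → ℝ) : Prop :=
  ∀ p x y, R x y → φ (.step p x) = φ (.step p y)

/-- The distributions `ν` and `μ` are indistinguishable by `R`-invariant observables. -/
def Indist (R : X → X → Prop) (ν μ : Dist (Outcome Act Out X)) : Prop :=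
  ∀ φ : Outcome Act Out X → ℝ, Invariant R φ → expect ν φ = expect μ φ

/-- The indicator of an outcome that is not a step vanishes on all steps, so it is invariant under
any relation. -/
theorem Indist.weights_eq {R : X → X → Prop} {ν μ : Dist (Outcome Act Out X)}
    (h : Indist R ν μ) {o : Outcome Act Out X} (ho : ∀ p x, o ≠ .step p x) :
    ν.weights o = μ.weights o := by
  rw [← expect_indicator_singleton, ← expect_indicator_singleton μ]
  refine h _ fun p x y _ => ?_
  rw [Set.indicator_of_notMem fun h => ho p x (Set.mem_singleton_iff.1 h).symm,
    Set.indicator_of_notMem fun h => ho p y (Set.mem_singleton_iff.1 h).symm]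

/-- A larger relation has fewer invariant observables. This makes the chain decreasing. -/
theorem Indist.mono {R S : X → X → Prop} (hRS : ∀ x y, R x y → S x y)
    {ν μ : Dist (Outcome Act Out X)} (h : Indist R ν μ) : Indist S ν μ :=
  fun φ hφ => h φ fun p x y hxy => hφ p x y (hRS x y hxy)

theorem mem_stepSet {p q : Act} {x : X} {A : Set X} :
    (Outcome.step q x : Outcome Act Out X) ∈ stepSet p A ↔ q = p ∧ x ∈ A := by
  simp only [stepSet, Set.mem_ofPred_eq, Outcome.step.injEq]
  exact ⟨fun ⟨y, hy, hq, hx⟩ => ⟨hq, hx ▸ hy⟩, fun ⟨hq, hx⟩ => ⟨x, hx, hq, rfl⟩⟩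

theorem stepSet_mono (p : Act) {A B : Set X} (h : A ⊆ B) :
    (stepSet p A : Set (Outcome Act Out X)) ⊆ stepSet p B :=
  fun _ ⟨x, hx, ho⟩ => ⟨x, h hx, ho⟩

/-- For an equivalence relation, `Φ` relates the states whose transitions are indistinguishable. -/
theorem phi_iff_indist {β : Automaton T Act Out X} {R : X → X → Prop} (hR : Equivalence R)
    {x y : X} : Phi β β R x y ↔ ∀ α, Indist R (β x α) (β y α) := by
  refine forall_congr' fun α => ⟨fun ⟨⟨h1, h2, h3⟩, h4, h5⟩ => ?_, fun h => ?_⟩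
  -- Invariant observables are those that factor through the quotient by `R`, so it is enough that
  -- the two image distributions there coincide.
  · let s : Setoid X := ⟨R, hR⟩
    have hmap : (β x α).map (Outcome.map (Quotient.mk s)) =
        (β y α).map (Outcome.map (Quotient.mk s)) := by
      refine StdSimplex.ext (Finsupp.ext fun o => ?_)
      cases o with
      | reject => rw [weights_map_reject, weights_map_reject, h1]
      | accept => rw [weights_map_accept, weights_map_accept, h2]
      | ret v => rw [weights_map_ret, weights_map_ret, h3]
      | step p q =>
        rw [weights_map_step, weights_map_step]
        -- A class is closed under `R`, so the two inequalities of `Φ` bound its masses by each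
        -- other.
        refine le_antisymm ((h4 _ p).trans (mass_mono _ (stepSet_mono p ?_)))
          ((h5 _ p).trans (mass_mono _ (stepSet_mono p ?_)))
        · rintro b ⟨a, ha, hab⟩
          exact (Quotient.sound (s := s) hab).symm.trans ha
        · rintro b ⟨a, ha, hab⟩
          exact (Quotient.sound (s := s) hab).trans ha
    intro φ hφ
    let ψ : Outcome Act Out (Quotient s) → ℝ
      | .reject => φ .reject
      | .accept => φ .accept
      | .ret v => φ (.ret v)
      | .step p q => Quotient.lift (fun x => φ (.step p x)) (fun a b hab => hφ p a b hab) q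
    have hψ : φ = ψ ∘ Outcome.map (Quotient.mk s) := by
      funext o; cases o <;> rfl
    rw [hψ, ← expect_map, hmap, expect_map]
  · refine ⟨⟨h.weights_eq (by simp), h.weights_eq (by simp), fun v => h.weights_eq (by simp)⟩,
      fun A p => ?_, fun A p => ?_⟩
    -- Enlarge `A` to its saturation: the indicator of the latter is invariant, so both
    -- distributions give it the same mass.
    · have hA : A ⊆ {b | ∃ a ∈ A, R a b} := fun a ha => ⟨a, ha, hR.refl a⟩
      refine (mass_mono _ (stepSet_mono p hA)).trans_eq ?_
      rw [← expect_indicator, ← expect_indicator]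
      refine h _ fun q a b hab => ?_
      have : (Outcome.step q a : Outcome Act Out X) ∈ stepSet p {y' | ∃ x' ∈ A, R x' y'} ↔
          (Outcome.step q b : Outcome Act Out X) ∈ stepSet p {y' | ∃ x' ∈ A, R x' y'} := by
        rw [mem_stepSet, mem_stepSet]
        exact and_congr_right fun _ => exists_congr fun c => and_congr_right fun _ =>
          ⟨fun k => hR.trans k hab, fun k => hR.trans k (hR.symm hab)⟩
      classical
      simp only [Set.indicator_apply, this, Pi.one_apply]
    · have hA : A ⊆ {b | ∃ a ∈ A, R b a} := fun a ha => ⟨a, ha, hR.refl a⟩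
      refine (mass_mono _ (stepSet_mono p hA)).trans_eq ?_
      rw [← expect_indicator, ← expect_indicator]
      refine (h _ fun q a b hab => ?_).symm
      have : (Outcome.step q a : Outcome Act Out X) ∈ stepSet p {x' | ∃ y' ∈ A, R x' y'} ↔
          (Outcome.step q b : Outcome Act Out X) ∈ stepSet p {x' | ∃ y' ∈ A, R x' y'} := by
        rw [mem_stepSet, mem_stepSet]
        exact and_congr_right fun _ => exists_congr fun c => and_congr_right fun _ =>
          ⟨fun k => hR.trans (hR.symm hab) k, fun k => hR.trans hab k⟩
      classical
      simp only [Set.indicator_apply, this, Pi.one_apply]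

variable (β : Automaton T Act Out X)

/-- Equality of expectations is an equivalence. The induction supplies the equivalence at level `n`
that `phi_iff_indist` needs in order to describe level `n + 1`. -/
theorem chain_equivalence (n : ℕ) : Equivalence (chain β n) := by
  induction n with
  | zero => exact ⟨fun _ => trivial, fun _ => trivial, fun _ _ => trivial⟩
  | succ n ih =>
    refine ⟨fun x => ?_, fun {x y} h => ?_, fun {x y z} h k => ?_⟩
    · exact (phi_iff_indist ih).2 fun α φ _ => rfl
    · exact (phi_iff_indist ih).2 fun α φ hφ => ((phi_iff_indist ih).1 h α φ hφ).symm
    · exact (phi_iff_indist ih).2 fun α φ hφ =>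
        ((phi_iff_indist ih).1 h α φ hφ).trans ((phi_iff_indist ih).1 k α φ hφ)

variable {β}

theorem chain_succ_iff {n : ℕ} {x y : X} :
    chain β (n + 1) x y ↔ ∀ α, Indist (chain β n) (β x α) (β y α) :=
  phi_iff_indist (chain_equivalence β n)

theorem chain_of_succ {n : ℕ} : ∀ {x y : X}, chain β (n + 1) x y → chain β n x y := by
  induction n with
  | zero => exact fun _ => trivial
  | succ n ih =>
    intro x y h
    exact chain_succ_iff.2 fun α => (chain_succ_iff.1 h α).mono fun _ _ => ih

theorem chain_antitone {m n : ℕ} (h : m ≤ n) {x y : X} (hxy : chain β n x y) :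
    chain β m x y := by
  induction n, h using Nat.le_induction with
  | base => exact hxy
  | succ n _ ih => exact ih (chain_of_succ hxy)

end Invariant

/-! ### Bisimilarity as the limit of the refinement chain -/

/-- Two distributions that agree on the sets closed under an equivalence relation have a coupling
supported on it. -/
theorem exists_coupling {Z : Type*} {S : Z → Z → Prop} (hS : Equivalence S) {ν μ : Dist Z}
    (h : ∀ A : Set Z, (∀ a b, S a b → (a ∈ A ↔ b ∈ A)) → mass ν A = mass μ A) :
    ∃ ω : Dist {q : Z × Z // S q.1 q.2},
      ω.map (fun q => q.1.1) = ν ∧ ω.map (fun q => q.1.2) = μ := by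
  classical
  have hc (z : Z) : mass ν {w | S z w} = mass μ {w | S z w} :=
    h _ fun a b hab => ⟨fun k => hS.trans k hab, fun k => hS.trans k (hS.symm hab)⟩
  have hcc {a b : Z} (hab : S a b) : {w | S a w} = {w | S b w} :=
    Set.ext fun w => ⟨fun k => hS.trans (hS.symm hab) k, fun k => hS.trans hab k⟩
  set c : Z → ℝ := fun z => mass ν {w | S z w} with hcdef
  have hν (z : Z) : ∑ w ∈ ν.weights.support, (if S z w then ν.weights w else 0) = c z := by
    simp only [hcdef, mass, Finset.sum_filter]; rfl
  have hμ (z : Z) : ∑ w ∈ μ.weights.support, (if S z w then μ.weights w else 0) = c z := by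
    simp only [hcdef]; rw [hc]; simp only [mass, Finset.sum_filter]; rfl
  have hpos {z : Z} (hz : c z = 0) : ν.weights z = 0 ∧ μ.weights z = 0 := by
    have hs : ({z} : Set Z) ⊆ {w | S z w} := Set.singleton_subset_iff.2 (hS.refl z)
    refine ⟨le_antisymm ?_ (ν.nonneg z), le_antisymm ?_ (μ.nonneg z)⟩
    · rw [← mass_singleton]; exact (mass_mono ν hs).trans_eq hz
    · rw [← mass_singleton]; exact (mass_mono μ hs).trans_eq ((hc z).symm.trans hz)
  -- The coupling is independent within each class: `c` is the common mass of the class, and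
  -- dividing by it makes the marginals right. Where `c` is zero the quotient is zero by convention,
  -- which is harmless by `hpos`.
  let W : Z × Z → ℝ := fun q => ν.weights q.1 * μ.weights q.2 / c q.1
  let wt : {q : Z × Z // S q.1 q.2} →₀ ℝ :=
    Finsupp.onFinset ((ν.weights.support ×ˢ μ.weights.support).subtype fun q => S q.1 q.2)
      (fun q => W q.1) fun q hq => by
        simp only [W, ne_eq, div_eq_zero_iff, mul_eq_zero, not_or] at hq
        simpa using hq.1
  have hsum (φ : Z × Z → ℝ) : (wt.sum fun q s => s * φ q.1) =
      ∑ a ∈ ν.weights.support, ∑ b ∈ μ.weights.support,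
        if S a b then W (a, b) * φ (a, b) else 0 := by
    rw [Finsupp.onFinset_sum _ (by simp)]
    rw [Finset.sum_subtype_eq_sum_filter (f := fun q => W q * φ q), Finset.sum_filter,
      Finset.sum_product]
  have hfst (ψ : Z → ℝ) : (wt.sum fun q s => s * ψ q.1.1) = expect ν ψ := by
    rw [hsum fun q => ψ q.1]
    refine Finset.sum_congr rfl fun a ha => ?_
    have ha' : c a ≠ 0 := fun k => Finsupp.mem_support_iff.1 ha (hpos k).1
    calc _ = ∑ b ∈ μ.weights.support,
          (ν.weights a * ψ a / c a) * (if S a b then μ.weights b else 0) :=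
          Finset.sum_congr rfl fun b _ => by
            simp only [W, mul_ite, mul_zero]; split_ifs <;> ring
      _ = _ := by rw [← Finset.mul_sum, hμ]; field_simp
  have hsnd (ψ : Z → ℝ) : (wt.sum fun q s => s * ψ q.1.2) = expect μ ψ := by
    rw [hsum fun q => ψ q.2, Finset.sum_comm]
    refine Finset.sum_congr rfl fun b hb => ?_
    have hb' : c b ≠ 0 := fun k => Finsupp.mem_support_iff.1 hb (hpos k).2
    calc _ = ∑ a ∈ ν.weights.support,
          (μ.weights b * ψ b / c b) * (if S b a then ν.weights a else 0) :=
          Finset.sum_congr rfl fun a _ => by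
            by_cases hab : S a b
            · have : c a = c b := by simp only [hcdef, hcc hab]
              simp only [W, if_pos hab, if_pos (hS.symm hab), this]; ring
            · rw [if_neg hab, if_neg fun k => hab (hS.symm k), mul_zero]
      _ = _ := by rw [← Finset.mul_sum, hν]; field_simp
  have htotal : wt.sum (fun _ s => s) = 1 := by
    have := hfst fun _ => 1
    simpa [expect] using this
  refine ⟨⟨wt, fun q => div_nonneg (mul_nonneg (ν.nonneg _) (μ.nonneg _)) ?_, htotal⟩,
    eq_of_expect_eq fun ψ => ?_, eq_of_expect_eq fun ψ => ?_⟩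
  · exact Finset.sum_nonneg fun x _ => ν.nonneg x
  · rw [expect_map, ← hfst]; rfl
  · rw [expect_map, ← hsnd]; rfl

section Bisimilarity

variable {T Act Out X : Type*} {β : Automaton T Act Out X}

/-- States related by the whole chain have indistinguishable transitions. -/
theorem indist_of_forall_chain {x y : X} (h : ∀ n, chain β n x y) (α : Atom T) :
    Indist (fun a b => ∀ n, chain β n a b) (β x α) (β y α) := by
  classical
  intro φ hφ
  set S := (β x α).weights.support ∪ (β y α).weights.support
  -- A pair that some level separates is separated from that level on. Only finitely many pairs
  -- occur in the supports, so the maximum `M` of these levels decides all of them.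
  have hN (o o' : Outcome Act Out X) : ∃ N, ∀ p a b, o = .step p a → o' = .step p b →
      chain β N a b → ∀ n, chain β n a b := by
    by_cases k : ∃ p a b, o = .step p a ∧ o' = .step p b ∧ ∃ n, ¬ chain β n a b
    · obtain ⟨p, a, b, rfl, rfl, n, hn⟩ := k
      refine ⟨n, fun q c d hc hd hcd => absurd ?_ hn⟩
      cases hc; cases hd; exact hcd
    · push Not at k
      exact ⟨0, fun p a b ho ho' _ => k p a b ho ho'⟩
  choose N hN using hN
  set M := (S ×ˢ S).sup fun q => N q.1 q.2
  have hM {p : Act} {a b : X} (ha : Outcome.step p a ∈ S) (hb : Outcome.step p b ∈ S)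
      (hab : chain β M a b) : φ (.step p a) = φ (.step p b) := by
    refine hφ p a b (hN _ _ p a b rfl rfl (chain_antitone ?_ hab))
    exact Finset.le_sup (f := fun q : Outcome Act Out X × Outcome Act Out X => N q.1 q.2)
      (Finset.mk_mem_product ha hb)
  -- `φ` need not be invariant at level `M`, so it is replaced by a `ψ` that is, and that agrees
  -- with it on `S`: evaluate `φ` at a chosen point of `S` in the same level-`M` class. The choice
  -- depends only on the predicate `P`, hence only on the class; off the classes that meet `S` the
  -- value is arbitrary.
  let F (p : Act) (P : X → Prop) : ℝ := if h : ∃ b, P b then φ (.step p h.choose) else 0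
  let ψ : Outcome Act Out X → ℝ
    | .step p a => F p fun b => Outcome.step p b ∈ S ∧ chain β M a b
    | o => φ o
  have hψ : ∀ o ∈ S, φ o = ψ o := by
    intro o ho
    cases o with
    | step p a =>
      have hex : ∃ b, Outcome.step p b ∈ S ∧ chain β M a b :=
        ⟨a, ho, (chain_equivalence β M).refl a⟩
      change _ = F p _
      simp only [F, dif_pos hex]
      exact hM ho hex.choose_spec.1 hex.choose_spec.2
    | _ => rfl
  have hinv : Invariant (chain β M) ψ := by
    intro p a b hab
    refine congrArg (F p) (funext fun d => propext (and_congr_right fun _ => ?_))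
    exact ⟨(chain_equivalence β M).trans ((chain_equivalence β M).symm hab),
      (chain_equivalence β M).trans hab⟩
  rw [expect_congr (ψ := ψ) fun o ho =>
      hψ o (Finset.mem_union_left _ (Finsupp.mem_support_iff.2 ho)),
    expect_congr (ν := β y α) (ψ := ψ) fun o ho =>
      hψ o (Finset.mem_union_right _ (Finsupp.mem_support_iff.2 ho))]
  exact chain_succ_iff.1 (h (M + 1)) α ψ hinv

/-- An equivalence relation that relates states with indistinguishable transitions only is a
bisimulation. -/
theorem isBisimulation_of_indist {R : X → X → Prop} (hR : Equivalence R)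
    (h : ∀ x y, R x y → ∀ α, Indist R (β x α) (β y α)) : IsBisimulation β β R := by
  classical
  -- This is the lift of `R` to outcomes, phrased by observables so that it is an equivalence at
  -- once. `hlift` recovers its concrete form: equal outputs, or steps with the same action to
  -- `R`-related states.
  let S (o o' : Outcome Act Out X) : Prop := ∀ φ, Invariant R φ → φ o = φ o'
  have hS : Equivalence S := ⟨fun _ _ _ => rfl, fun h φ hφ => (h φ hφ).symm,
    fun h k φ hφ => (h φ hφ).trans (k φ hφ)⟩
  have hrel {p : Act} {x y : X} (hxy : R x y) :
      S (Outcome.step p x) (Outcome.step p y) := fun φ hφ => hφ p x y hxy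
  have hsing {o : Outcome Act Out X} (ho : ∀ p x, o ≠ .step p x) {o' : Outcome Act Out X}
      (k : S o o') : o = o' := by
    by_contra hne
    have := k (Set.indicator {o} 1) fun p x y _ => by
      rw [Set.indicator_of_notMem fun h => ho p x (Set.mem_singleton_iff.1 h).symm,
        Set.indicator_of_notMem fun h => ho p y (Set.mem_singleton_iff.1 h).symm]
    rw [Set.indicator_of_mem (Set.mem_singleton o),
      Set.indicator_of_notMem fun h => hne (Set.mem_singleton_iff.1 h).symm] at this
    exact one_ne_zero this
  have hlift (q : {q : Outcome Act Out X × Outcome Act Out X // S q.1 q.2}) :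
      ∃ z : Outcome Act Out {q : X × X // R q.1 q.2},
        Outcome.map (fun q => q.1.1) z = q.1.1 ∧ Outcome.map (fun q => q.1.2) z = q.1.2 := by
    obtain ⟨⟨o, o'⟩, k⟩ := q
    cases o with
    | reject => cases hsing (by simp) k; exact ⟨.reject, rfl, rfl⟩
    | accept => cases hsing (by simp) k; exact ⟨.accept, rfl, rfl⟩
    | ret v => cases hsing (by simp) k; exact ⟨.ret v, rfl, rfl⟩
    | step p x =>
      -- The indicator of the `p`-steps into the class of `x` is invariant and equals one at the
      -- first outcome, which forces the second to be such a step.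
      have := k ((stepSet p {y | R x y}).indicator 1) fun q a b hab => by
        have hiff : (Outcome.step q a : Outcome Act Out X) ∈ stepSet p {y | R x y} ↔
            (Outcome.step q b : Outcome Act Out X) ∈ stepSet p {y | R x y} := by
          rw [mem_stepSet, mem_stepSet]
          exact and_congr_right fun _ =>
            ⟨fun k => hR.trans k hab, fun k => hR.trans k (hR.symm hab)⟩
        simp only [Set.indicator_apply, hiff, Pi.one_apply]
      have hx : (Outcome.step p x : Outcome Act Out X) ∈ stepSet p {y | R x y} :=
        ⟨x, hR.refl x, rfl⟩
      rw [Set.indicator_of_mem hx] at this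
      obtain ⟨y, hy, rfl⟩ : o' ∈ stepSet p {y | R x y} := by
        by_contra hn
        rw [Set.indicator_of_notMem hn] at this
        exact one_ne_zero this
      exact ⟨.step p ⟨(x, y), hy⟩, rfl, rfl⟩
  choose c hc1 hc2 using hlift
  have hcoup (q : {q : X × X // R q.1 q.2}) (α : Atom T) :=
    exists_coupling hS (ν := β q.1.1 α) (μ := β q.1.2 α) fun A hA => by
      rw [← expect_indicator, ← expect_indicator]
      refine h _ _ q.2 α _ fun p a b hab => ?_
      simp only [Set.indicator_apply, hA _ _ (hrel (p := p) hab), Pi.one_apply]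
  choose ω hω1 hω2 using hcoup
  -- The coupling lives on pairs of outcomes; `c` carries it to outcomes over pairs of states.
  refine ⟨fun q α => (ω q α).map c, isHom_iff.2 fun q α => ?_, isHom_iff.2 fun q α => ?_⟩
  · rw [StdSimplex.map_map, ← hω1 q α]; simp only [hc1]
  · rw [StdSimplex.map_map, ← hω2 q α]; simp only [hc2]

/-- Bisimilarity is the intersection of the refinement chain. -/
theorem bisimilar_iff_forall_chain {x y : X} :
    Bisimilar β β x y ↔ ∀ n, chain β n x y := by
  constructor
  · rintro ⟨R, ⟨ρ, h1, h2⟩, hxy⟩ n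
    rw [isHom_iff] at h1 h2
    suffices key : ∀ q : {q : X × X // R q.1 q.2}, chain β n q.1.1 q.1.2 from key ⟨(x, y), hxy⟩
    induction n with
    | zero => exact fun _ => trivial
    | succ n ih =>
      refine fun q => chain_succ_iff.2 fun α φ hφ => ?_
      -- Both sides become expectations under the same `ρ q α`; the two pulled-back observables
      -- agree because, by induction, successor pairs are related at level `n`.
      rw [h1 q α, h2 q α, expect_map, expect_map]
      congr 1
      funext o
      cases o with
      | step p q' => exact hφ p _ _ (ih q')
      | _ => rfl
  · intro h
    refine ⟨fun a b => ∀ n, chain β n a b, isBisimulation_of_indist ⟨?_, ?_, ?_⟩ ?_, h⟩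
    · exact fun a n => (chain_equivalence β n).refl a
    · exact fun k n => (chain_equivalence β n).symm (k n)
    · exact fun k l n => (chain_equivalence β n).trans (k n) (l n)
    · exact fun a b k α => indist_of_forall_chain k α

theorem exists_isGreatest_chain {x y : X} (h : ¬ Bisimilar β β x y) :
    ∃ n : ℕ, IsGreatest {n | chain β n x y} n := by
  classical
  rw [bisimilar_iff_forall_chain, not_forall] at h
  -- Level `0` always holds, so the first failing level has a predecessor, which is the greatest
  -- level that holds.
  have hpos : Nat.find h ≠ 0 := fun k => Nat.find_spec h (k ▸ trivial)
  refine ⟨Nat.find h - 1, not_not.1 (Nat.find_min h (by omega)), fun m hm => ?_⟩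
  by_contra hlt
  exact Nat.find_spec h (chain_antitone (by omega) hm)

/-- The closed balls of radius `2⁻ⁿ` are the classes of level `n`; every property of the distance is
read off the chain through this. -/
theorem bdist_le_iff {x y : X} {n : ℕ} : bdist β x y ≤ ((2 : ℝ) ^ n)⁻¹ ↔ chain β n x y := by
  unfold bdist
  split_ifs with h
  · exact iff_of_true (by positivity) (bisimilar_iff_forall_chain.1 h n)
  · obtain ⟨m, hm⟩ := exists_isGreatest_chain h
    rw [hm.csSup_eq, inv_le_inv₀ (by positivity) (by positivity),
      pow_le_pow_iff_right₀ one_lt_two]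
    exact ⟨fun k => chain_antitone k hm.1, fun k => hm.2 k⟩

theorem bdist_nonneg (x y : X) : 0 ≤ bdist β x y := by
  unfold bdist
  split_ifs <;> positivity

theorem bdist_eq_zero_or (x y : X) : bdist β x y = 0 ∨ ∃ n : ℕ, bdist β x y = ((2 : ℝ) ^ n)⁻¹ := by
  unfold bdist
  split_ifs
  · exact .inl rfl
  · exact .inr ⟨_, rfl⟩

theorem bdist_eq_zero_iff {x y : X} : bdist β x y = 0 ↔ ∀ n, chain β n x y := by
  refine ⟨fun h n => bdist_le_iff.1 (h.trans_le (by positivity)), fun h => ?_⟩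
  exact if_pos (bisimilar_iff_forall_chain.2 h)

theorem bdist_self (x : X) : bdist β x x = 0 :=
  bdist_eq_zero_iff.2 fun n => (chain_equivalence β n).refl x

/-- The only possible values are `0` and the `2⁻ⁿ`, so comparing levels compares distances. -/
theorem bdist_le_of_chain_imp {x y x' y' : X} (h : ∀ n, chain β n x' y' → chain β n x y) :
    bdist β x y ≤ bdist β x' y' := by
  rcases bdist_eq_zero_or (β := β) x' y' with h0 | ⟨n, hn⟩
  · exact (bdist_eq_zero_iff.2 fun n => h n (bdist_eq_zero_iff.1 h0 n)).trans_le (bdist_nonneg _ _)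
  · rw [hn]
    exact bdist_le_iff.2 (h n (bdist_le_iff.1 hn.le))

theorem bdist_comm (x y : X) : bdist β x y = bdist β y x :=
  le_antisymm (bdist_le_of_chain_imp fun n => (chain_equivalence β n).symm)
    (bdist_le_of_chain_imp fun n => (chain_equivalence β n).symm)

/-- A level reached by the more distant of the two pairs is reached by both, and each level is
transitive. -/
theorem bdist_triangle_max (x y z : X) :
    bdist β x z ≤ max (bdist β x y) (bdist β y z) := by
  rcases le_total (bdist β x y) (bdist β y z) with h | h
  · rw [max_eq_right h]
    exact bdist_le_of_chain_imp fun n k =>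
      (chain_equivalence β n).trans (bdist_le_iff.1 (h.trans (bdist_le_iff.2 k))) k
  · rw [max_eq_left h]
    exact bdist_le_of_chain_imp fun n k =>
      (chain_equivalence β n).trans k (bdist_le_iff.1 (h.trans (bdist_le_iff.2 k)))

/-- A map on finite families that raises the level of the refinement chain by one halves the
product distance. -/
theorem prodDist_le_half {I : Type*} [Finite I] {m n m' n' : I → X}
    (h : ∀ k, (∀ i, chain β k (m i) (n i)) → ∀ i, chain β (k + 1) (m' i) (n' i)) :
    prodDist β m' n' ≤ 1 / 2 * prodDist β m n := by
  rcases isEmpty_or_nonempty I with hI | hI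
  · simp [prodDist, Real.iSup_of_isEmpty]
  refine ciSup_le fun i => ?_
  have hle (j : I) : bdist β (m j) (n j) ≤ prodDist β m n :=
    le_ciSup (f := fun j => bdist β (m j) (n j)) (Set.finite_range _).bddAbove j
  -- A finite supremum is attained, so the product distance is itself `0` or some `2⁻ᵏ`.
  obtain ⟨j, hj⟩ := exists_eq_ciSup_of_finite (f := fun j => bdist β (m j) (n j))
  change _ = prodDist β m n at hj
  rcases bdist_eq_zero_or (β := β) (m j) (n j) with h0 | ⟨k, hk⟩
  · rw [← hj, h0, mul_zero]
    refine (bdist_eq_zero_iff.2 fun k => chain_of_succ (h k (fun l => ?_) i)).le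
    exact bdist_le_iff.1 ((hle l).trans (by rw [← hj, h0]; positivity))
  · rw [← hj, hk, one_div, ← mul_inv, ← pow_succ']
    exact bdist_le_iff.2 (h k (fun l => bdist_le_iff.1 ((hle l).trans (by rw [← hj, hk]))) i)

end Bisimilarity

/-! ### Satisfaction of tests -/

section Tests

variable {T : Type u} (α : Atom T)

theorem Atom.sat_one : α.Sat .one := by
  obtain ⟨a, ha⟩ := α
  induction a using Quotient.inductionOn with | _ c =>
  exact BExp.cls_le_iff.2 fun _ _ => rfl

theorem Atom.not_sat_zero : ¬ α.Sat .zero := fun h => α.2.1 (le_bot_iff.1 h)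

theorem Atom.sat_and (b c : BExp T) : α.Sat (b.and c) ↔ α.Sat b ∧ α.Sat c := by
  obtain ⟨a, ha⟩ := α
  induction a using Quotient.inductionOn with | _ d =>
  change d.cls ≤ _ ↔ d.cls ≤ _ ∧ d.cls ≤ _
  simp only [BExp.cls_le_iff, BExp.eval, Bool.and_eq_true]
  exact ⟨fun h => ⟨fun v k => (h v k).1, fun v k => (h v k).2⟩, fun h v k => ⟨h.1 v k, h.2 v k⟩⟩

theorem Atom.sat_congr {b c : BExp T} (h : BEquiv b c) : α.Sat b ↔ α.Sat c := by
  unfold Atom.Sat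
  rw [BExp.cls_eq.2 h]

end Tests

/-! ### Expectations of derivatives -/

section Derivatives

variable {T : Type u} {Act : Type v} {Out : Type w}

/-- The other weights are nonnegative with sum zero. It serves the diverging loop, whose body
accepts surely. -/
theorem expect_eq_of_weight_eq_one {X : Type*} {ν : Dist X} {x : X} (h : ν.weights x = 1)
    (φ : X → ℝ) : expect ν φ = φ x := by
  classical
  suffices ν = .single x by rw [this, expect_single]
  refine StdSimplex.support_weights_eq_singleton.1 ?_
  have hsum : (ν.weights.erase x).sum (fun _ s => s) = 0 := by
    have := Finsupp.add_sum_erase' ν.weights x (fun _ s => s) (fun _ => rfl)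
    rw [ν.total, h] at this
    linarith
  have hz := (Finset.sum_eq_zero_iff_of_nonneg fun y hy => by
    rw [Finsupp.support_erase, Finset.mem_erase] at hy
    rw [Finsupp.erase_ne hy.1]; exact ν.nonneg y).1 hsum
  ext y
  rw [Finset.mem_singleton, Finsupp.mem_support_iff]
  refine ⟨fun hy => ?_, fun hy => by rw [hy, h]; exact one_ne_zero⟩
  by_contra hne
  have hy' := hz y (by rw [Finsupp.support_erase, Finset.mem_erase]; exact ⟨hne, by simpa using hy⟩)
  rw [Finsupp.erase_ne hne] at hy'
  exact hy hy'

/-- The observable on the successors of `e` that gives the expectation of `φ` after `e ; f`. -/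
noncomputable def seqObs (f : Exp T Act Out) (α : Atom T)
    (φ : Outcome Act Out (Exp T Act Out) → ℝ) : Outcome Act Out (Exp T Act Out) → ℝ
  | .reject => φ .reject
  | .accept => expect (deriv f α) φ
  | .ret v => φ (.ret v)
  | .step p e => φ (.step p (.seq e f))

/-- The observable `φ` after the successors are changed by `k`, disregarding acceptance. -/
def loopObs {X : Type*} (k : X → X) (φ : Outcome Act Out X → ℝ) : Outcome Act Out X → ℝ
  | .reject => φ .reject
  | .accept => 0
  | .ret v => φ (.ret v)
  | .step p x => φ (.step p (k x))

open Classical in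
/-- One iteration of a loop with continuation probability `r` and body behaviour `ν`. -/
noncomputable def loopStep {X : Type*} (r : unitInterval) (ν : Dist (Outcome Act Out X))
    (k : X → X) : Dist (Outcome Act Out X) :=
  if h : r = 1 ∧ ν.weights .accept = 1 then .single .reject else loopDist r ν k h

theorem expect_loopStep_of_diverge {X : Type*} {r : unitInterval} {ν : Dist (Outcome Act Out X)}
    {k : X → X} (h : r = 1 ∧ ν.weights .accept = 1) (φ : Outcome Act Out X → ℝ) :
    expect (loopStep r ν k) φ = φ .reject := by
  rw [loopStep, dif_pos h, expect_single]

theorem expect_loopStep {X : Type*} {r : unitInterval} {ν : Dist (Outcome Act Out X)}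
    {k : X → X} (h : ¬(r = 1 ∧ ν.weights .accept = 1)) (φ : Outcome Act Out X → ℝ) :
    expect (loopStep r ν k) φ =
      ((1 - r) * φ .accept + r * expect ν (loopObs k φ)) / (1 - r * ν.weights .accept) := by
  classical
  rw [loopStep, dif_neg h]
  have hz : ∀ o : Outcome Act Out X, 0 * φ o = 0 := fun o => zero_mul _
  have hadd : ∀ (o : Outcome Act Out X) (a b : ℝ), (a + b) * φ o = a * φ o + b * φ o :=
    fun o a b => add_mul _ _ _
  -- `loopObs` vanishes at acceptance, so erasing that outcome changes nothing.
  have hE : ((ν.weights.erase .accept).sum fun o s => s * φ (Outcome.map k o)) =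
      expect ν (loopObs k φ) := by
    rw [expect, ← Finsupp.add_sum_erase' ν.weights .accept (fun o s => s * loopObs k φ o)
      fun _ => zero_mul _]
    simp only [loopObs, mul_zero, zero_add]
    refine Finsupp.sum_congr fun o ho => ?_
    cases o with
    | accept => simp at ho
    | _ => rfl
  rw [expect, loopDist, Finsupp.sum_add_index' hz hadd, Finsupp.sum_single_index (hz _),
    Finsupp.sum_smul_index hz]
  simp only [mul_assoc]
  rw [← Finsupp.mul_sum, Finsupp.sum_mapDomain_index hz hadd, hE]
  ring

/-- Splitting off immediate acceptance expresses `e ; f` through `loopObs`, the quantity in which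
loops are computed. -/
theorem expect_seqObs (ν : Dist (Outcome Act Out (Exp T Act Out))) (f : Exp T Act Out)
    (α : Atom T) (φ : Outcome Act Out (Exp T Act Out) → ℝ) :
    expect ν (seqObs f α φ) =
      expect ν (loopObs (fun e => .seq e f) φ) + ν.weights .accept * expect (deriv f α) φ := by
  classical
  rw [← expect_indicator_singleton ν .accept, mul_comm, ← expect_const_mul, ← expect_add]
  congr 1
  funext o
  cases o <;> simp [seqObs, loopObs]

theorem expect_loopObs_accept {X : Type*} (ν : Dist (Outcome Act Out X)) (k : X → X) :
    expect ν (loopObs k (Set.indicator {.accept} 1)) = 0 := by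
  refine Finset.sum_eq_zero fun o _ => ?_
  cases o <;> simp [loopObs]

/-- The fixpoint equation of a loop. -/
theorem expect_loopStep_eq {X : Type*} (r : unitInterval) (ν : Dist (Outcome Act Out X))
    (k : X → X) (φ : Outcome Act Out X → ℝ) :
    expect (loopStep r ν k) φ =
      r * (expect ν (loopObs k φ) + ν.weights .accept * expect (loopStep r ν k) φ) +
        (1 - r) * φ .accept := by
  -- If the loop diverges, the equation degenerates to an identity: `loopObs` contributes zero and
  -- the loop's own expectation has coefficient one.
  by_cases h : r = 1 ∧ ν.weights .accept = 1
  · rw [expect_eq_of_weight_eq_one h.2, h.1, h.2]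
    simp [loopObs]
  · have hd := loop_denom_pos r ν .accept h
    rw [expect_loopStep h]
    field_simp
    ring

variable (α : Atom T) (φ : Outcome Act Out (Exp T Act Out) → ℝ)

theorem expect_deriv_act (p : Act) :
    expect (deriv (.act p) α) φ = φ (.step p (.test .one)) := by
  rw [deriv, expect_single]

theorem expect_deriv_ret (v : Out) : expect (deriv (.ret v) α) φ = φ (.ret v) := by
  rw [deriv, expect_single]

open Classical in
theorem expect_deriv_test (b : BExp T) :
    expect (deriv (.test b) α) φ = if α.Sat b then φ .accept else φ .reject := by
  rw [deriv]
  split_ifs <;> rw [expect_single]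

open Classical in
theorem expect_deriv_gchoice (b : BExp T) (e f : Exp T Act Out) :
    expect (deriv (.gchoice b e f) α) φ =
      if α.Sat b then expect (deriv e α) φ else expect (deriv f α) φ := by
  rw [deriv]
  split_ifs <;> rfl

theorem expect_deriv_pchoice (r : unitInterval) (e f : Exp T Act Out) :
    expect (deriv (.pchoice r e f) α) φ =
      r * expect (deriv e α) φ + (1 - r) * expect (deriv f α) φ := by
  rw [deriv, expect_convexCombPair]

theorem expect_deriv_seq (e f : Exp T Act Out) :
    expect (deriv (.seq e f) α) φ = expect (deriv e α) (seqObs f α φ) := by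
  rw [deriv, expect_iConvexComb]
  congr 1
  funext o
  cases o <;> simp [seqObs]

theorem deriv_ploop (r : unitInterval) (e : Exp T Act Out) :
    deriv (.ploop r e) α = loopStep r (deriv e α) fun e' => .seq e' (.ploop r e) := by
  rw [deriv, loopStep]

theorem deriv_gloop_of_sat {b : BExp T} {α : Atom T} (h : α.Sat b) (e : Exp T Act Out) :
    deriv (.gloop b e) α = loopStep 1 (deriv e α) fun e' => .seq e' (.gloop b e) := by
  rw [deriv, if_pos h, loopStep]

theorem deriv_gloop_of_not_sat {b : BExp T} {α : Atom T} (h : ¬ α.Sat b) (e : Exp T Act Out) :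
    deriv (.gloop b e) α = .single .accept := by
  rw [deriv, if_neg h]

/-- This links the syntactic side condition `E(g) = 0` to the transitions: such a `g` never accepts
in its first step. -/
theorem weights_deriv_accept (e : Exp T Act Out) :
    (deriv e α).weights .accept = term e α := by
  induction e with
  | act p => rw [← expect_indicator_singleton, expect_deriv_act]; simp [term]
  | ret v => rw [← expect_indicator_singleton, expect_deriv_ret]; simp [term]
  | test b => rw [← expect_indicator_singleton, expect_deriv_test]; simp [term]
  | gchoice b e f he hf =>
    rw [← expect_indicator_singleton, expect_deriv_gchoice, expect_indicator_singleton,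
      expect_indicator_singleton, he, hf, term]
  | pchoice r e f he hf =>
    rw [← expect_indicator_singleton, expect_deriv_pchoice, expect_indicator_singleton,
      expect_indicator_singleton, he, hf, term]
  | seq e f he hf =>
    rw [← expect_indicator_singleton, expect_deriv_seq, expect_seqObs,
      expect_indicator_singleton, he, hf, term, expect_loopObs_accept,
      zero_add]
  | gloop b e he =>
    by_cases hb : α.Sat b
    · rw [← expect_indicator_singleton, deriv_gloop_of_sat hb, term,
        if_neg fun k => (α.sat_not b).1 k hb]
      by_cases h : (1 : unitInterval) = 1 ∧ (deriv e α).weights .accept = 1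
      · rw [expect_loopStep_of_diverge h]; simp
      · rw [expect_loopStep h, expect_loopObs_accept]; simp
    · rw [deriv_gloop_of_not_sat hb, term, if_pos ((α.sat_not b).2 hb)]; simp
  | ploop r e he =>
    rw [← expect_indicator_singleton, deriv_ploop, term, ← he]
    split_ifs with h
    · rw [expect_loopStep_of_diverge h]; simp
    · rw [expect_loopStep h, expect_loopObs_accept]; simp

end Derivatives

/-! ### The refinement chain on expressions -/

/-- Related expressions cannot be told apart within `n` steps. -/
local notation:50 e " ≈[" n "] " f => chain deriv n e f

section Congruence

variable {T : Type u} {Act : Type v} {Out : Type w}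

/-- It settles the axioms whose two sides have the same derivative. -/
theorem chain_of_expect_eq {e f : Exp T Act Out}
    (h : ∀ α φ, expect (deriv e α) φ = expect (deriv f α) φ) (n : ℕ) : e ≈[n] f := by
  cases n with
  | zero => trivial
  | succ n => exact chain_succ_iff.2 fun α φ _ => h α φ

theorem chain_gchoice_congr {n : ℕ} (b : BExp T) {e e' f f' : Exp T Act Out}
    (he : e ≈[n] e') (hf : f ≈[n] f') : .gchoice b e f ≈[n] .gchoice b e' f' := by
  cases n with
  | zero => trivial
  | succ n =>
    refine chain_succ_iff.2 fun α φ hφ => ?_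
    rw [expect_deriv_gchoice, expect_deriv_gchoice, chain_succ_iff.1 he α φ hφ,
      chain_succ_iff.1 hf α φ hφ]

theorem chain_pchoice_congr {n : ℕ} (r : unitInterval) {e e' f f' : Exp T Act Out}
    (he : e ≈[n] e') (hf : f ≈[n] f') : .pchoice r e f ≈[n] .pchoice r e' f' := by
  cases n with
  | zero => trivial
  | succ n =>
    refine chain_succ_iff.2 fun α φ hφ => ?_
    rw [expect_deriv_pchoice, expect_deriv_pchoice, chain_succ_iff.1 he α φ hφ,
      chain_succ_iff.1 hf α φ hφ]

/-- By induction `seqObs f α φ` is invariant at level `n`, so `e` may be exchanged under it.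
Exchanging `f` then needs level `n + 1` only at acceptance; behind an action level `n` suffices. -/
theorem chain_seq_congr {n : ℕ} {e e' f f' : Exp T Act Out}
    (he : e ≈[n] e') (hf : f ≈[n] f') : .seq e f ≈[n] .seq e' f' := by
  induction n generalizing e e' f f' with
  | zero => trivial
  | succ n ih =>
    refine chain_succ_iff.2 fun α φ hφ => ?_
    have hinv : Invariant (chain deriv n) (seqObs f α φ) := fun p x y hxy =>
      hφ p _ _ (ih hxy ((chain_equivalence _ n).refl f))
    rw [expect_deriv_seq, expect_deriv_seq, chain_succ_iff.1 he α _ hinv]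
    refine expect_congr fun o _ => ?_
    cases o with
    | accept => exact chain_succ_iff.1 hf α φ hφ
    | step p x => exact hφ p _ _ (ih ((chain_equivalence _ n).refl x) (chain_of_succ hf))
    | _ => rfl

/-- A body that never accepts immediately delays the difference of its continuations. -/
theorem chain_succ_seq_right {n : ℕ} {g f f' : Exp T Act Out} (hg : ∀ α, term g α = 0)
    (hf : f ≈[n] f') : .seq g f ≈[n + 1] .seq g f' := by
  refine chain_succ_iff.2 fun α φ hφ => ?_
  rw [expect_deriv_seq, expect_deriv_seq]
  refine expect_congr fun o ho => ?_
  cases o with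
  -- Only here would level `n + 1` of the continuations be needed, and this outcome has weight zero.
  | accept => exact absurd ((weights_deriv_accept α g).trans (hg α)) ho
  | step p x => exact hφ p _ _ (chain_seq_congr ((chain_equivalence _ n).refl x) hf)
  | _ => rfl

/-- The acceptance weight is the same for both bodies, so both loops diverge or both are normalised
by the same denominator. The maps `k` and `k'` may append different loops. -/
theorem indist_loopStep {X : Type*} {R : X → X → Prop} (r : unitInterval)
    {ν μ : Dist (Outcome Act Out X)} {k k' : X → X} (h : Indist R ν μ)
    (hk : ∀ x, R (k x) (k' x)) (hR : ∀ x y, R x y → R (k x) (k y)) :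
    Indist R (loopStep r ν k) (loopStep r μ k') := by
  intro φ hφ
  have hacc : ν.weights .accept = μ.weights .accept := h.weights_eq (by simp)
  have hinv : Invariant R (loopObs k φ) := fun p x y hxy => hφ p _ _ (hR x y hxy)
  have hobs : loopObs k φ = loopObs k' φ := by
    funext o
    cases o with
    | step p x => exact hφ p _ _ (hk x)
    | _ => rfl
  by_cases hd : r = 1 ∧ ν.weights .accept = 1
  · rw [expect_loopStep_of_diverge hd, expect_loopStep_of_diverge (hacc ▸ hd)]
  · rw [expect_loopStep hd, expect_loopStep (hacc ▸ hd), h _ hinv, hobs, hacc]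

/-- The loop reappears only behind an action, where level `n` is enough, so induction on the level
closes. -/
theorem chain_ploop_congr {n : ℕ} (r : unitInterval) {e e' : Exp T Act Out}
    (he : e ≈[n] e') : .ploop r e ≈[n] .ploop r e' := by
  induction n with
  | zero => trivial
  | succ n ih =>
    refine chain_succ_iff.2 fun α => ?_
    rw [deriv_ploop, deriv_ploop]
    have hrefl := (chain_equivalence (deriv (T := T) (Act := Act) (Out := Out)) n).refl
    exact indist_loopStep r (chain_succ_iff.1 he α)
      (fun x => chain_seq_congr (hrefl x) (ih (chain_of_succ he)))
      fun x y hxy => chain_seq_congr hxy (hrefl _)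

theorem chain_gloop_congr {n : ℕ} (b : BExp T) {e e' : Exp T Act Out}
    (he : e ≈[n] e') : .gloop b e ≈[n] .gloop b e' := by
  induction n with
  | zero => trivial
  | succ n ih =>
    refine chain_succ_iff.2 fun α => ?_
    by_cases hb : α.Sat b
    · rw [deriv_gloop_of_sat hb, deriv_gloop_of_sat hb]
      have hrefl := (chain_equivalence (deriv (T := T) (Act := Act) (Out := Out)) n).refl
      exact indist_loopStep 1 (chain_succ_iff.1 he α)
        (fun x => chain_seq_congr (hrefl x) (ih (chain_of_succ he)))
        fun x y hxy => chain_seq_congr hxy (hrefl _)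
    · rw [deriv_gloop_of_not_sat hb, deriv_gloop_of_not_sat hb]
      exact fun _ _ => rfl

/-! ### Salomaa systems -/

variable {X : Type*}

/-- Every indeterminate stands behind a factor that never accepts at once, hence the gain of one
level. -/
theorem PTerm.chain_subst {n : ℕ} {h k : X → Exp T Act Out} (hk : ∀ x, h x ≈[n] k x) :
    ∀ {p : PTerm T Act Out X}, p.IsSalomaa → p.subst h ≈[n + 1] p.subst k
  | .exp f, _ => (chain_equivalence _ (n + 1)).refl f
  | .var _ x, hg => chain_succ_seq_right hg (hk x)
  | .pchoice r _ _, hpq => chain_pchoice_congr r (chain_subst hk hpq.1) (chain_subst hk hpq.2)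

theorem ETerm.chain_subst {n : ℕ} {h k : X → Exp T Act Out} (hk : ∀ x, h x ≈[n] k x) :
    ∀ {e : ETerm T Act Out X}, e.IsSalomaa → e.subst h ≈[n + 1] e.subst k
  | .pterm _, hp => PTerm.chain_subst hk hp
  | .gchoice b _ _, hef => chain_gchoice_congr b (chain_subst hk hef.1) (chain_subst hk hef.2)

/-- Solutions of a Salomaa system up to all levels of the chain agree up to all levels. -/
theorem chain_of_isSolution {τ : X → ETerm T Act Out X} (hτ : IsSalomaaSystem τ)
    {f g : X → Exp T Act Out} (hf : ∀ n x, f x ≈[n] (τ x).subst f)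
    (hg : ∀ n x, g x ≈[n] (τ x).subst g) (n : ℕ) (x : X) : f x ≈[n] g x := by
  induction n generalizing x with
  | zero => trivial
  | succ n ih =>
    have he := chain_equivalence (deriv (T := T) (Act := Act) (Out := Out)) (n + 1)
    exact he.trans (hf _ x) (he.trans (ETerm.chain_subst ih (hτ x)) (he.symm (hg _ x)))

end Congruence

/-! ### Soundness -/

section Soundness

variable {T : Type u} {Act : Type v} {Out : Type w}

theorem expect_deriv_seq_test (b : BExp T) (e : Exp T Act Out) (α : Atom T)
    (φ : Outcome Act Out (Exp T Act Out) → ℝ) [Decidable (α.Sat b)] :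
    expect (deriv (.seq (.test b) e) α) φ =
      if α.Sat b then expect (deriv e α) φ else φ .reject := by
  rw [expect_deriv_seq, expect_deriv_test]
  split_ifs <;> rfl

/-- Successors keep the trailing `1`, so the derivatives can differ as distributions; induction on
the level identifies the successors. Associativity behaves likewise. -/
theorem chain_seq_one (e : Exp T Act Out) (n : ℕ) : .seq e (.test .one) ≈[n] e := by
  induction n generalizing e with
  | zero => trivial
  | succ n ih =>
    refine chain_succ_iff.2 fun α φ hφ => ?_
    rw [expect_deriv_seq]
    refine expect_congr fun o _ => ?_
    cases o with
    | accept => exact (expect_deriv_test α φ .one).trans (if_pos α.sat_one)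
    | step p x => exact hφ p _ _ (ih x)
    | _ => rfl

theorem chain_seq_assoc (e f g : Exp T Act Out) (n : ℕ) :
    .seq (.seq e f) g ≈[n] .seq e (.seq f g) := by
  induction n generalizing e with
  | zero => trivial
  | succ n ih =>
    refine chain_succ_iff.2 fun α φ hφ => ?_
    rw [expect_deriv_seq, expect_deriv_seq, expect_deriv_seq]
    refine expect_congr fun o _ => ?_
    cases o with
    | accept => exact (expect_deriv_seq α φ f g).symm
    | step p x => exact hφ p _ _ (ih x)
    | _ => rfl

theorem expect_deriv_ploop (r : unitInterval) (e : Exp T Act Out) (α : Atom T)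
    (φ : Outcome Act Out (Exp T Act Out) → ℝ) :
    expect (deriv (.ploop r e) α) φ =
      r * expect (deriv e α) (seqObs (.ploop r e) α φ) + (1 - r) * φ .accept := by
  rw [expect_seqObs, deriv_ploop]
  exact expect_loopStep_eq ..

theorem expect_deriv_gloop (b : BExp T) (e : Exp T Act Out) (α : Atom T)
    (φ : Outcome Act Out (Exp T Act Out) → ℝ) [Decidable (α.Sat b)] :
    expect (deriv (.gloop b e) α) φ =
      if α.Sat b then expect (deriv e α) (seqObs (.gloop b e) α φ) else φ .accept := by
  split_ifs with hb
  · rw [expect_seqObs, deriv_gloop_of_sat hb]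
    simpa using expect_loopStep_eq 1 (deriv e α) (fun e' => .seq e' (.gloop b e)) φ
  · rw [deriv_gloop_of_not_sat hb, expect_single]

theorem chain_gloop_gchoice_one (b c : BExp T) (e : Exp T Act Out) (n : ℕ) :
    .gloop b (.gchoice c e (.test .one)) ≈[n] .gloop b (.seq (.test c) e) := by
  induction n with
  | zero => trivial
  | succ n ih =>
    have hrefl := (chain_equivalence (deriv (T := T) (Act := Act) (Out := Out)) n).refl
    refine chain_succ_iff.2 fun α => ?_
    by_cases hb : α.Sat b
    · rw [deriv_gloop_of_sat hb, deriv_gloop_of_sat hb]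
      by_cases hc : α.Sat c
      · refine indist_loopStep 1 (fun φ _ => ?_) (fun x => chain_seq_congr (hrefl x) ih)
          fun x y hxy => chain_seq_congr hxy (hrefl _)
        classical
        rw [expect_deriv_gchoice, expect_deriv_seq_test, if_pos hc, if_pos hc]
      -- Outside `c` the bodies differ: one accepts, the other rejects. A loop entered surely turns
      -- sure acceptance into rejection, so the loops still agree.
      · intro φ _
        have h1 : deriv (.gchoice c e (.test .one)) α =
            Convexity.StdSimplex.single .accept := by
          refine eq_of_expect_eq fun ψ => ?_
          rw [expect_deriv_gchoice, if_neg hc, expect_deriv_test, if_pos α.sat_one, expect_single]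
        have h2 : deriv (.seq (.test c) e) α = Convexity.StdSimplex.single .reject := by
          classical
          refine eq_of_expect_eq fun ψ => ?_
          rw [expect_deriv_seq_test, if_neg hc, expect_single]
        rw [h1, h2, expect_loopStep_of_diverge (by simp), expect_loopStep (by simp)]
        simp [loopObs]
    · rw [deriv_gloop_of_not_sat hb, deriv_gloop_of_not_sat hb]
      exact fun _ _ => rfl

theorem chain_gloop_one (e : Exp T Act Out) (n : ℕ) : .gloop .one e ≈[n] .ploop 1 e := by
  induction n with
  | zero => trivial
  | succ n ih =>
    have hrefl := (chain_equivalence (deriv (T := T) (Act := Act) (Out := Out)) n).refl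
    refine chain_succ_iff.2 fun α => ?_
    rw [deriv_gloop_of_sat α.sat_one, deriv_ploop]
    exact indist_loopStep 1 (fun _ _ => rfl) (fun x => chain_seq_congr (hrefl x) ih)
      fun x y hxy => chain_seq_congr hxy (hrefl _)

/-- The expectation of a body that skips with probability `1 - s`, as its first step is seen by
observables invariant up to level `n`. -/
theorem expect_seqObs_of_chain {n : ℕ} {c : BExp T} {s : unitInterval} {e f g : Exp T Act Out}
    (h : e ≈[n + 1] .gchoice c (.pchoice s f (.test .one)) g) {α : Atom T} (hc : α.Sat c)
    (l : Exp T Act Out) {φ : Outcome Act Out (Exp T Act Out) → ℝ}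
    (hφ : Invariant (chain deriv n) φ) :
    expect (deriv e α) (seqObs l α φ) =
      s * expect (deriv f α) (seqObs l α φ) + (1 - s) * expect (deriv l α) φ := by
  have hinv : Invariant (chain deriv n) (seqObs l α φ) := fun p x y hxy =>
    hφ p _ _ (chain_seq_congr hxy ((chain_equivalence _ n).refl l))
  rw [chain_succ_iff.1 h α _ hinv, expect_deriv_gchoice, if_pos hc, expect_deriv_pchoice,
    expect_deriv_test, if_pos α.sat_one]
  rfl

/-- Where `b` and `c` hold, the expectations `L` of the loop and `F` of `f` followed by the loop
satisfy `L = s F + (1 - s) L`, and `s > 0` gives `L = F`. -/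
theorem chain_of_gloop_skip {c b : BExp T} {s : unitInterval} {e f g : Exp T Act Out}
    (h : ∀ n, e ≈[n] .gchoice c (.pchoice s f (.test .one)) g) (hs : (0 : ℝ) < s) (n : ℕ) :
    .seq (.test c) (.gloop b e) ≈[n]
      .seq (.test c) (.gchoice b (.seq f (.gloop b e)) (.test .one)) := by
  classical
  cases n with
  | zero => trivial
  | succ n =>
    refine chain_succ_iff.2 fun α φ hφ => ?_
    rw [expect_deriv_seq_test, expect_deriv_seq_test]
    by_cases hc : α.Sat c
    · rw [if_pos hc, if_pos hc, expect_deriv_gchoice]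
      have hL := expect_deriv_gloop b e α φ
      by_cases hb : α.Sat b
      · rw [if_pos hb, expect_seqObs_of_chain (h _) hc _ hφ] at hL
        rw [if_pos hb, expect_deriv_seq]
        refine mul_left_cancel₀ hs.ne' ?_
        linear_combination hL
      · rw [hL, if_neg hb, if_neg hb, expect_deriv_test, if_pos α.sat_one]
    · rw [if_neg hc, if_neg hc]

/-- Here `L = r (s F + (1 - s) L) + (1 - r) A`, with `A` the value at acceptance. Solving for `L`
gives `F` the weight `t`, and `A` the weight `1 - t` since `1 - r (1 - s) - r s = 1 - r`. -/
theorem chain_of_ploop_skip {c : BExp T} {r s t : unitInterval} {e f g : Exp T Act Out}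
    (h : ∀ n, e ≈[n] .gchoice c (.pchoice s f (.test .one)) g)
    (hrs : (1 - r * (1 - s) : ℝ) ≠ 0) (ht : (t : ℝ) = r * s / (1 - r * (1 - s))) (n : ℕ) :
    .seq (.test c) (.ploop r e) ≈[n]
      .seq (.test c) (.pchoice t (.seq f (.ploop r e)) (.test .one)) := by
  classical
  cases n with
  | zero => trivial
  | succ n =>
    refine chain_succ_iff.2 fun α φ hφ => ?_
    rw [expect_deriv_seq_test, expect_deriv_seq_test]
    by_cases hc : α.Sat c
    · rw [if_pos hc, if_pos hc, expect_deriv_pchoice, expect_deriv_seq, expect_deriv_test,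
        if_pos α.sat_one]
      have hL := expect_deriv_ploop r e α φ
      rw [expect_seqObs_of_chain (h _) hc _ hφ] at hL
      rw [eq_div_iff hrs] at ht
      refine mul_left_cancel₀ hrs ?_
      linear_combination hL - (expect (deriv f α) (seqObs (.ploop r e) α φ) - φ .accept) * ht
    · rw [if_neg hc, if_neg hc]

/-- Provably equivalent expressions are related by the whole chain. -/
theorem ProvEq.chain {e f : Exp T Act Out} (h : ProvEq e f) : ∀ n, e ≈[n] f := by
  classical
  induction h with
  | refl e => exact fun n => (chain_equivalence _ n).refl e
  | symm _ ih => exact fun n => (chain_equivalence _ n).symm (ih n)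
  | trans _ _ ih ih' => exact fun n => (chain_equivalence _ n).trans (ih n) (ih' n)
  | gchoice_congr b _ _ ih ih' => exact fun n => chain_gchoice_congr b (ih n) (ih' n)
  | seq_congr _ _ ih ih' => exact fun n => chain_seq_congr (ih n) (ih' n)
  | gloop_congr b _ ih => exact fun n => chain_gloop_congr b (ih n)
  | pchoice_congr r _ _ ih ih' => exact fun n => chain_pchoice_congr r (ih n) (ih' n)
  | ploop_congr r _ ih => exact fun n => chain_ploop_congr r (ih n)
  | G1 b e =>
    refine chain_of_expect_eq fun α φ => ?_
    rw [expect_deriv_gchoice, ite_self]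
  | G2 b e f =>
    refine chain_of_expect_eq fun α φ => ?_
    rw [expect_deriv_gchoice, expect_deriv_gchoice, expect_deriv_seq_test]
    split_ifs <;> rfl
  | G3 b e f =>
    refine chain_of_expect_eq fun α φ => ?_
    rw [expect_deriv_gchoice, expect_deriv_gchoice]
    by_cases hb : α.Sat b <;> simp [α.sat_not, hb]
  | G4 b c e f g =>
    refine chain_of_expect_eq fun α φ => ?_
    simp only [expect_deriv_gchoice]
    by_cases hb : α.Sat b <;> by_cases hc : α.Sat c <;> simp [α.sat_and, hb, hc]
  | D r b e f g =>
    refine chain_of_expect_eq fun α φ => ?_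
    simp only [expect_deriv_gchoice, expect_deriv_pchoice]
    split_ifs <;> rfl
  | S1 e =>
    refine chain_of_expect_eq fun α φ => ?_
    rw [expect_deriv_seq_test, if_pos α.sat_one]
  | S2 e => exact chain_seq_one e
  | S3 e f g => exact chain_seq_assoc e f g
  | S4 e =>
    refine chain_of_expect_eq fun α φ => ?_
    rw [expect_deriv_seq_test, expect_deriv_test, if_neg α.not_sat_zero, if_neg α.not_sat_zero]
  | S5 b e f g =>
    refine chain_of_expect_eq fun α φ => ?_
    simp only [expect_deriv_seq, expect_deriv_gchoice]
  | S6 r e f g =>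
    refine chain_of_expect_eq fun α φ => ?_
    simp only [expect_deriv_seq, expect_deriv_pchoice]
  | S7 v e =>
    refine chain_of_expect_eq fun α φ => ?_
    rw [expect_deriv_seq, expect_deriv_ret, expect_deriv_ret]
    rfl
  | S8 b c =>
    refine chain_of_expect_eq fun α φ => ?_
    rw [expect_deriv_seq_test, expect_deriv_test, expect_deriv_test]
    by_cases hb : α.Sat b <;> by_cases hc : α.Sat c <;> simp [α.sat_and, hb, hc]
  | P1 r e =>
    refine chain_of_expect_eq fun α φ => ?_
    rw [expect_deriv_pchoice]
    ring
  | P2 e f =>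
    refine chain_of_expect_eq fun α φ => ?_
    rw [expect_deriv_pchoice]
    simp
  | P3 r e f =>
    refine chain_of_expect_eq fun α φ => ?_
    rw [expect_deriv_pchoice, expect_deriv_pchoice, unitInterval.coe_symm_eq]
    ring
  | P4 r s t e f g hrs ht =>
    refine chain_of_expect_eq fun α φ => ?_
    simp only [expect_deriv_pchoice, Set.Icc.coe_mul]
    rw [eq_div_iff hrs] at ht
    linear_combination (expect (deriv g α) φ - expect (deriv f α) φ) * ht
  | L1 b e =>
    refine chain_of_expect_eq fun α φ => ?_
    rw [expect_deriv_gloop, expect_deriv_gchoice, expect_deriv_seq, expect_deriv_test,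
      if_pos α.sat_one]
  | L2 r e =>
    refine chain_of_expect_eq fun α φ => ?_
    rw [expect_deriv_ploop, expect_deriv_pchoice, expect_deriv_seq, expect_deriv_test,
      if_pos α.sat_one]
  | L3 b c e => exact chain_gloop_gchoice_one b c e
  | L4 e => exact chain_gloop_one e
  | L5 b c s e f g _ hs ih => exact chain_of_gloop_skip ih hs
  | L6 c r s t e f g _ hrs ht ih => exact chain_of_ploop_skip ih hrs ht
  | F1 b e f g _ he ih =>
    -- Both `g` and the loop followed by `f` solve the one-variable system `x = e x +_b f`, which is
    -- Salomaa as `E(e) = 0`. For the loop this is unfolding and reassociation.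
    refine fun n => chain_of_isSolution (X := Unit)
      (τ := fun _ => .gchoice b (.pterm (.var e ())) (.pterm (.exp f)))
      (f := fun _ => g) (g := fun _ => .seq (.gloop b e) f)
      (fun _ => ⟨he, trivial⟩) (fun n _ => ih n) (fun n _ => ?_) n ()
    refine (chain_equivalence _ n).trans (y := .gchoice b (.seq (.seq e (.gloop b e)) f) f)
      (chain_of_expect_eq (fun α φ => ?_) n)
      (chain_gchoice_congr b (chain_seq_assoc ..) ((chain_equivalence _ n).refl f))
    rw [expect_deriv_seq, expect_deriv_gloop, expect_deriv_gchoice, expect_deriv_seq,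
      expect_deriv_seq]
    rfl
  | F2 r e f g _ he ih =>
    refine fun n => chain_of_isSolution (X := Unit)
      (τ := fun _ => .pterm (.pchoice r (.var e ()) (.exp f)))
      (f := fun _ => g) (g := fun _ => .seq (.ploop r e) f)
      (fun _ => ⟨he, trivial⟩) (fun n _ => ih n) (fun n _ => ?_) n ()
    refine (chain_equivalence _ n).trans (y := .pchoice r (.seq (.seq e (.ploop r e)) f) f)
      (chain_of_expect_eq (fun α φ => ?_) n)
      (chain_pchoice_congr r (chain_seq_assoc ..) ((chain_equivalence _ n).refl f))
    rw [expect_deriv_seq, expect_deriv_ploop, expect_deriv_pchoice, expect_deriv_seq,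
      expect_deriv_seq]
    rfl
  | test_ba h =>
    refine chain_of_expect_eq fun α φ => ?_
    simp only [expect_deriv_test, α.sat_congr h]
  | gchoice_ba e f h =>
    refine chain_of_expect_eq fun α φ => ?_
    simp only [expect_deriv_gchoice, α.sat_congr h]
  | @gloop_ba b c e h =>
    -- The guards stay syntactically different inside the successors, so equality of expectations is
    -- not available and induction on the level is used.
    intro n
    induction n with
    | zero => trivial
    | succ n ih =>
      have hrefl := (chain_equivalence (deriv (T := T) (Act := Act) (Out := Out)) n).refl
      refine chain_succ_iff.2 fun α => ?_
      by_cases hb : α.Sat b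
      · rw [deriv_gloop_of_sat hb, deriv_gloop_of_sat ((α.sat_congr h).1 hb)]
        exact indist_loopStep 1 (fun _ _ => rfl) (fun x => chain_seq_congr (hrefl x) ih)
          fun x y hxy => chain_seq_congr hxy (hrefl _)
      · rw [deriv_gloop_of_not_sat hb, deriv_gloop_of_not_sat fun k => hb ((α.sat_congr h).2 k)]
        exact fun _ _ => rfl

/-- Expressions equivalent by the axioms and UA are related by the whole chain. -/
theorem ProvEqUA.chain {e f : Exp T Act Out} (h : ProvEqUA e f) : ∀ n, e ≈[n] f := by
  induction h with
  | of h => exact h.chain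
  | symm _ ih => exact fun n => (chain_equivalence _ n).symm (ih n)
  | trans _ _ ih ih' => exact fun n => (chain_equivalence _ n).trans (ih n) (ih' n)
  | gchoice_congr b _ _ ih ih' => exact fun n => chain_gchoice_congr b (ih n) (ih' n)
  | seq_congr _ _ ih ih' => exact fun n => chain_seq_congr (ih n) (ih' n)
  | gloop_congr b _ ih => exact fun n => chain_gloop_congr b (ih n)
  | pchoice_congr r _ _ ih ih' => exact fun n => chain_pchoice_congr r (ih n) (ih' n)
  | ploop_congr r _ ih => exact fun n => chain_ploop_congr r (ih n)
  | ua X τ hτ f g _ _ x ihf ihg =>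
    exact fun n => chain_of_isSolution hτ (fun n x => ihf x n) (fun n x => ihg x n) n x

theorem bisim_satisfiesUA : SatisfiesUA (Bisim (T := T) (Act := Act) (Out := Out)) :=
  fun _ _ _ hτ _ _ hf hg x => bisimilar_iff_forall_chain.2 fun n =>
    chain_of_isSolution hτ (fun n x => bisimilar_iff_forall_chain.1 (hf x) n)
      (fun n x => bisimilar_iff_forall_chain.1 (hg x) n) n x

end Soundness

end ProbGKAT

theorem mainTheorem2 {T : Type*} [Finite T] {Act : Type*} {Out : Type*} :
    -- soundness of the axioms together with UA
    (∀ e f : ProbGKAT.Exp T Act Out, ProbGKAT.ProvEqUA e f → ProbGKAT.Bisim e f) ∧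
    -- UA is satisfied by bisimilarity
    ProbGKAT.SatisfiesUA (ProbGKAT.Bisim (T := T) (Act := Act) (Out := Out)) ∧
    -- the behavioural distance on expressions is well defined: the maximal index exists
    (∀ e f : ProbGKAT.Exp T Act Out, ¬ ProbGKAT.Bisim e f →
      ∃ n : ℕ, IsGreatest {n | ProbGKAT.chain ProbGKAT.deriv n e f} n) ∧
    -- it is a pseudo-ultrametric
    (∀ e f g : ProbGKAT.Exp T Act Out,
      ProbGKAT.bdist ProbGKAT.deriv e e = 0 ∧
      ProbGKAT.bdist ProbGKAT.deriv e f = ProbGKAT.bdist ProbGKAT.deriv f e ∧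
      ProbGKAT.bdist ProbGKAT.deriv e g ≤
        max (ProbGKAT.bdist ProbGKAT.deriv e f) (ProbGKAT.bdist ProbGKAT.deriv f g)) ∧
    -- for every Salomaa system the induced map is 1/2-Lipschitz for the product distance
    (∀ (X : Type) [Finite X] (τ : X → ProbGKAT.ETerm T Act Out X), ProbGKAT.IsSalomaaSystem τ →
      ∀ m n : X → ProbGKAT.Exp T Act Out,
        ProbGKAT.prodDist ProbGKAT.deriv (ProbGKAT.substMap τ m) (ProbGKAT.substMap τ n) ≤
          1 / 2 * ProbGKAT.prodDist ProbGKAT.deriv m n) := by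
  exact ⟨fun _ _ h => ProbGKAT.bisimilar_iff_forall_chain.2 h.chain,
    ProbGKAT.bisim_satisfiesUA, fun _ _ h => ProbGKAT.exists_isGreatest_chain h,
    fun e f g => ⟨ProbGKAT.bdist_self e, ProbGKAT.bdist_comm e f,
      ProbGKAT.bdist_triangle_max e f g⟩,
    fun _ _ _ hτ _ _ => ProbGKAT.prodDist_le_half fun _ h x =>
      ProbGKAT.ETerm.chain_subst h (hτ x)⟩
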